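/- Let $X_1,\ldots,X_n$ be independent real random variables, let $\mathcal{C}$ be a collection of subsets of $[n]=\{1,\ldots,n\}$, let $r$ be the maximum number of sets of $\mathcal{C}$ in which any one index $i\in[n]$ appears, and write $T^{(s)}=\sum_{i\in s}X_i$ for $s\subseteq[n]$ and $T_n=T^{([n])}$. For a random variable $X$ with an absolutely continuous density $f$ (i.e. absolutely continuous on every compact interval) let $I(X)=E[\rho(X)^2]\in(0,\infty]$ with $\rho=f'/f$ be its Fisher information; put $I(X)=\infty$ if $X$ has no such density, and $1/\infty=0$. Suppose that $T^{(s)}$ has an absolutely continuous density for every $s\in\mathcal{C}$. Then $$\frac{1}{I(T_n)}\;\ge\;\frac1r\sum_{s\in\mathcal{C}}\frac{1}{I(T^{(s)})}$$ (the right side is read as $0$ if $\mathcal{C}$ is empty). Call $\mathcal{C}$ discriminating if for any distinct $i,j\in[n]$ some set of $\mathcal{C}$ contains $i$ but not $j$, and balanced if every index $i\in[n]$ appears in exactly $r$ sets of $\mathcal{C}$. If $n\ge2$, no $X_i$ is almost surely constant, and $\mathcal{C}$ is discriminating, then the two sides are positive and equal if and only if each $X_i$ is normal (with positive variance) and $\mathcal{C}$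 is balanced. -/

import Mathlib

open MeasureTheory ProbabilityTheory
open scoped ENNReal NNReal

/-- `f` is an absolutely continuous probability density of the measure `μ` on `ℝ`: a nonnegative
function, absolutely continuous on every compact interval, with `dμ = f dx`. Such an `f` is
continuous, hence determined by `μ`. -/
def IsACDensity (μ : Measure ℝ) (f : ℝ → ℝ) : Prop :=
  (∀ x, 0 ≤ f x) ∧ (∀ a b, AbsolutelyContinuousOnInterval f a b) ∧
    μ = (volume : Measure ℝ).withDensity (fun x => ENNReal.ofReal (f x))

/-- `μ` has an absolutely continuous density. -/
def HasACDensity (μ : Measure ℝ) : Prop := ∃ f, IsACDensity μ f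

/-- The score function `f' / f` of a density `f` (`f` is differentiable almost everywhere when it
is absolutely continuous, and it is positive almost everywhere for the measure `f dx`). -/
noncomputable def score (f : ℝ → ℝ) (x : ℝ) : ℝ := deriv f x / f x

/-- The Fisher information `E[ρ(X)²] ∈ [0, ∞]` of a random variable with law `μ`, where
`ρ` is the score function of the absolutely continuous density of `μ`. There is at most one such
density, so the infimum is over at most one value; it is `∞` if there is no such density. -/
noncomputable def fisherInfo (μ : Measure ℝ) : ℝ≥0∞ :=
  ⨅ (f : ℝ → ℝ) (_ : IsACDensity μ f), ∫⁻ x, ENNReal.ofReal (score f x ^ 2) ∂μ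

/-- The subset sum `T^(s) = ∑_{i ∈ s} X_i`. -/
def subsetSum {Ω : Type*} {n : ℕ} (X : Fin n → Ω → ℝ) (s : Finset (Fin n)) : Ω → ℝ :=
  fun ω => ∑ i ∈ s, X i ω

/-- The number of sets of the collection `C` in which the index `i` appears. -/
def indexCount {n : ℕ} (C : Finset (Finset (Fin n))) (i : Fin n) : ℕ :=
  (C.filter (fun s => i ∈ s)).card

/-- The maximum number `r` of sets of `C` in which any one index appears. -/
def maxCount {n : ℕ} (C : Finset (Finset (Fin n))) : ℕ :=
  Finset.univ.sup (indexCount C)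

/-- For any distinct indices `i`, `j` there is a set in `C` that contains `i` but not `j`. -/
def IsDiscriminating {n : ℕ} (C : Finset (Finset (Fin n))) : Prop :=
  ∀ i j : Fin n, i ≠ j → ∃ s ∈ C, i ∈ s ∧ j ∉ s

/-- Each index appears in the same number (namely `r`) of sets of `C`. -/
def IsBalanced {n : ℕ} (C : Finset (Finset (Fin n))) : Prop :=
  ∀ i : Fin n, indexCount C i = maxCount C

/-- `Y` is normally distributed, with a positive variance. -/
def IsNormalRV {Ω : Type*} [MeasurableSpace Ω] (P : Measure Ω) (Y : Ω → ℝ) : Prop :=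
  ∃ (m : ℝ) (v : ℝ≥0), 0 < v ∧ P.map Y = gaussianReal m v

/-!
On the product space of the laws of the `X i`, let `ρ_s` be the score of the sum `T_s` over `s`,
and `ρ` the score of the total sum `T`. Whenever `T_s` has finite Fisher information, `ρ(T)` is the
conditional expectation of `ρ_s(T_s)` given `T` (`IsACDensity.integral_mul_score_conv`). For weights
`w_s` of sum `1`, the function `ρ(T)` is therefore the projection of `Ψ = ∑ w_s ρ_s(T_s)`, so that
`I(T) ≤ ∫ Ψ²`, with equality only for `Ψ = ρ(T)` (`integral_sub_score_sq`). The summands of `Ψ` are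
centred functions of the coordinates in `s`, and every coordinate occurs in at most `r` of them, so
`∫ Ψ² ≤ r ∑ w_s² I(T_s)` (`variance_drop`). This is proved by averaging out one coordinate at a
time, with the Cauchy–Schwarz inequality for the part that depends on this coordinate. The weights
proportional to `1 / I(T_s)` give the inequality (`sum_one_div_fisherInfo_le`).

In the case of equality, the part of `Ψ` that depends on a coordinate `i ∈ s` is `r` times that of
`w_s ρ_s(T_s)` (`variance_drop_eq`), and hence `ρ(T) - r w_s ρ_s(T_s)` does not depend on the
coordinates in `s`. Thus, for almost every value `w` of the sum over the complement of `s`, there is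
a constant `k` with `ρ(z + w) = r w_s ρ_s(z) + k` for almost every `z`. If `w_s ≠ 0` and the set of
these `w` is uncountable, then it accumulates at one of its points. The difference quotients of
`log f_s`, where `f_s` is the density of `T_s`, along the resulting sequence of steps are affine
functions, so `log f_s` is locally a quadratic polynomial, and `T` is normal
(`IsACDensity.eq_gaussianReal_of_not_countable`). Now some index `i` lies in no set of weight zero,
since otherwise `Ψ` would not depend on any coordinate. If the set of the `w` is countable for every
`s` that contains `i`, then, since the collection is discriminating, all the other coordinates are
supported by countable sets. So is then a sum over a set in the collection that does not contain
`i`, which contradicts the existence of its density (`exists_sumLaw_univ_eq_gaussianReal`).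

Once `T` is normal, every `X i` is normal by Cramér's theorem (`cramer`). It is proved by means of
the moment generating function, which is a zero-free entire function of order at most `2`. For
normal `X i` both sides are sums of variances, and equality means that every index occurs in exactly
`r` sets (`fisherInfo_eq_iff`).
-/

open Filter Topology

/-! ### Absolutely continuous densities and their scores -/

namespace IsACDensity

variable {μ : Measure ℝ} {f : ℝ → ℝ}

lemma continuous (h : IsACDensity μ f) : Continuous f := by
  rw [continuous_iff_continuousAt]
  intro x
  exact (h.2.1 (x - 1) (x + 1)).continuousOn.continuousAt (by
    rw [Set.uIcc_of_le (by linarith)]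
    exact Icc_mem_nhds (by linarith) (by linarith))

lemma lintegral_eq (h : IsACDensity μ f) (g : ℝ → ℝ≥0∞) (hg : AEMeasurable g) :
    ∫⁻ x, g x ∂μ = ∫⁻ x, ENNReal.ofReal (f x) * g x := by
  conv_lhs => rw [h.2.2]
  rw [lintegral_withDensity_eq_lintegral_mul₀ (by have := h.continuous; fun_prop) hg]
  rfl

lemma integral_eq (h : IsACDensity μ f) (g : ℝ → ℝ) :
    ∫ x, g x ∂μ = ∫ x, f x * g x := by
  conv_lhs => rw [h.2.2]
  rw [integral_withDensity_eq_integral_toReal_smul (by have := h.continuous; fun_prop) (by simp)]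
  simp [ENNReal.toReal_ofReal (h.1 _)]

lemma integrable_iff (h : IsACDensity μ f) (g : ℝ → ℝ) :
    Integrable g μ ↔ Integrable (fun x => f x * g x) := by
  conv_lhs => rw [h.2.2]
  rw [integrable_withDensity_iff_integrable_smul' (by have := h.continuous; fun_prop) (by simp)]
  simp [ENNReal.toReal_ofReal (h.1 _)]

lemma ae_iff (h : IsACDensity μ f) (p : ℝ → Prop) :
    (∀ᵐ x ∂μ, p x) ↔ ∀ᵐ x, 0 < f x → p x := by
  conv_lhs => rw [h.2.2]
  rw [ae_withDensity_iff (by have := h.continuous; fun_prop)]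
  simp

lemma absolutelyContinuous (h : IsACDensity μ f) : μ ≪ volume := by
  rw [h.2.2]
  exact withDensity_absolutelyContinuous _ _

lemma lintegral_eq_one [IsProbabilityMeasure μ] (h : IsACDensity μ f) :
    ∫⁻ x, ENNReal.ofReal (f x) = 1 := by
  have := h.lintegral_eq (fun _ => 1) aemeasurable_const
  simpa using this.symm

lemma integrable [IsProbabilityMeasure μ] (h : IsACDensity μ f) : Integrable f := by
  simpa using (h.integrable_iff (fun _ => 1)).1 (integrable_const _)

lemma integral_eq_one [IsProbabilityMeasure μ] (h : IsACDensity μ f) : ∫ x, f x = 1 := by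
  simpa using (h.integral_eq (fun _ => 1)).symm

lemma unique [IsProbabilityMeasure μ] {g : ℝ → ℝ} (hf : IsACDensity μ f) (hg : IsACDensity μ g) :
    f = g := by
  have hf' := hf.continuous
  have hg' := hg.continuous
  have h := (withDensity_eq_iff (μ := volume) (by fun_prop) (by fun_prop)
    (by rw [hf.lintegral_eq_one]; simp)).1 (hf.2.2.symm.trans hg.2.2)
  refine hf'.ae_eq_iff_eq volume hg' |>.1 ?_
  filter_upwards [h] with x hx
  exact (ENNReal.ofReal_eq_ofReal_iff (hf.1 x) (hg.1 x)).1 hx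

lemma fisherInfo_eq [IsProbabilityMeasure μ] (hf : IsACDensity μ f) :
    fisherInfo μ = ∫⁻ x, ENNReal.ofReal (score f x ^ 2) ∂μ := by
  refine le_antisymm (iInf₂_le f hf) ?_
  refine le_iInf₂ fun g hg => ?_
  rw [hf.unique hg]

/-- A zero of a nonnegative function is a minimum, so the derivative vanishes there and the
junk value `x / 0 = 0` in the score does no harm. -/
lemma deriv_eq (hf : IsACDensity μ f) (x : ℝ) : deriv f x = f x * score f x := by
  unfold score
  by_cases h : f x = 0
  · have : IsLocalMin f x := Eventually.of_forall fun y => by rw [h]; exact hf.1 y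
    rw [this.deriv_eq_zero, h, zero_mul]
  · field_simp

lemma measurable_score (hf : IsACDensity μ f) : Measurable (score f) :=
  (measurable_deriv f).div hf.continuous.measurable

lemma integral_deriv (hf : IsACDensity μ f) (a b : ℝ) : ∫ x in a..b, deriv f x = f b - f a :=
  (hf.2.1 a b).integral_deriv_eq_sub

lemma ae_differentiableAt (hf : IsACDensity μ f) : ∀ᵐ x, DifferentiableAt ℝ f x := by
  have : ∀ n : ℕ, ∀ᵐ x, x ∈ Set.uIcc (-(n : ℝ)) n → DifferentiableAt ℝ f x :=
    fun n => (hf.2.1 _ _).ae_differentiableAt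
  filter_upwards [ae_all_iff.2 this] with x hx
  obtain ⟨n, hn⟩ := exists_nat_ge |x|
  refine hx n ?_
  rw [Set.uIcc_of_le (by linarith [abs_nonneg x])]
  exact abs_le.1 hn

section FiniteInfo

variable [IsProbabilityMeasure μ]

lemma memLp_score (hf : IsACDensity μ f) (hI : fisherInfo μ ≠ ∞) : MemLp (score f) 2 μ := by
  rw [memLp_two_iff_integrable_sq hf.measurable_score.aestronglyMeasurable]
  refine ⟨by have := hf.measurable_score; fun_prop, ?_⟩
  rw [hasFiniteIntegral_iff_ofReal (Eventually.of_forall fun x => sq_nonneg _)]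
  rw [hf.fisherInfo_eq] at hI
  exact lt_top_iff_ne_top.2 hI

lemma fisherInfo_eq_ofReal (hf : IsACDensity μ f) (hI : MemLp (score f) 2 μ) :
    fisherInfo μ = ENNReal.ofReal (∫ x, score f x ^ 2 ∂μ) := by
  rw [hf.fisherInfo_eq, ofReal_integral_eq_lintegral_ofReal hI.integrable_sq
    (Eventually.of_forall fun x => sq_nonneg _)]

lemma integrable_score (hf : IsACDensity μ f) (hI : fisherInfo μ ≠ ∞) :
    Integrable (score f) μ := (hf.memLp_score hI).integrable (by norm_num)

lemma integrable_deriv (hf : IsACDensity μ f) (hI : fisherInfo μ ≠ ∞) :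
    Integrable (deriv f) := by
  have := (hf.integrable_iff _).1 (hf.integrable_score hI)
  simpa only [← hf.deriv_eq] using this

lemma exists_bound (hf : IsACDensity μ f) (hI : fisherInfo μ ≠ ∞) : ∃ K, ∀ x, |f x| ≤ K := by
  refine ⟨|f 0| + ∫ t, |deriv f t|, fun x => ?_⟩
  have h1 := hf.integral_deriv 0 x
  have h2 : |∫ t in (0 : ℝ)..x, deriv f t| ≤ ∫ t, |deriv f t| := by
    rw [← Real.norm_eq_abs]
    refine (intervalIntegral.norm_integral_le_integral_norm_uIoc).trans ?_
    exact setIntegral_le_integral (hf.integrable_deriv hI).norm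
      (Eventually.of_forall fun x => norm_nonneg _)
  have h3 : f x = f 0 + ∫ t in (0 : ℝ)..x, deriv f t := by rw [h1]; ring
  rw [h3]
  exact (abs_add_le _ _).trans (by gcongr)

lemma tendsto_atTop (hf : IsACDensity μ f) (hI : fisherInfo μ ≠ ∞) : Tendsto f atTop (𝓝 0) := by
  have h1 := intervalIntegral_tendsto_integral_Ioi 0 (hf.integrable_deriv hI).integrableOn
    tendsto_id
  simp only [hf.integral_deriv, id] at h1
  have h2 := h1.add_const (f 0)
  simp only [sub_add_cancel] at h2
  have h3 := (hf.integrable.integrableAtFilter atTop).eq_zero_of_tendsto (fun s hs => by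
    obtain ⟨a, ha⟩ := mem_atTop_sets.1 hs
    exact measure_mono_top (fun x hx => ha x hx) (Real.volume_Ici (a := a))) h2
  rwa [h3] at h2

lemma tendsto_atBot (hf : IsACDensity μ f) (hI : fisherInfo μ ≠ ∞) : Tendsto f atBot (𝓝 0) := by
  have h1 := intervalIntegral_tendsto_integral_Iic 0 (hf.integrable_deriv hI).integrableOn
    tendsto_id
  simp only [hf.integral_deriv, id] at h1
  have h2 := h1.const_sub (f 0)
  simp only [sub_sub_cancel] at h2
  have h3 := (hf.integrable.integrableAtFilter atBot).eq_zero_of_tendsto (fun s hs => by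
    obtain ⟨a, ha⟩ := mem_atBot_sets.1 hs
    exact measure_mono_top (fun x hx => ha x hx) (Real.volume_Iic (a := a))) h2
  rwa [h3] at h2

/-- The score has mean zero, because the density vanishes at both ends of the line. -/
lemma integral_score (hf : IsACDensity μ f) (hI : fisherInfo μ ≠ ∞) :
    ∫ x, score f x ∂μ = 0 := by
  rw [hf.integral_eq]
  simp only [← hf.deriv_eq]
  have h1 := intervalIntegral_tendsto_integral (hf.integrable_deriv hI)
    (tendsto_neg_atTop_atBot (G := ℝ)) tendsto_id
  simp only [hf.integral_deriv, id] at h1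
  have h2 := (hf.tendsto_atTop hI).sub ((hf.tendsto_atBot hI).comp tendsto_neg_atTop_atBot)
  simpa using tendsto_nhds_unique h1 h2

/-- The Fisher information is positive: otherwise the density would be constant. -/
lemma fisherInfo_ne_zero (hf : IsACDensity μ f) : fisherInfo μ ≠ 0 := by
  intro h0
  rw [hf.fisherInfo_eq, lintegral_eq_zero_iff (by have := hf.measurable_score; fun_prop)] at h0
  have h1 : ∀ᵐ x, deriv f x = 0 := by
    filter_upwards [(hf.ae_iff _).1 h0] with x hx
    rw [hf.deriv_eq]
    rcases (hf.1 x).eq_or_lt with h | h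
    · simp [← h]
    · have := hx h
      simp only [Pi.zero_apply, ENNReal.ofReal_eq_zero] at this
      have : score f x = 0 := by nlinarith [sq_nonneg (score f x)]
      simp [this]
  have h2 : ∀ x, f x = f 0 := by
    intro x
    have := hf.integral_deriv 0 x
    rw [intervalIntegral.integral_zero_ae (by filter_upwards [h1] with x hx _ using hx)] at this
    linarith
  have h3 := hf.integrable
  rw [show f = fun _ => f 0 from funext h2, integrable_const_iff] at h3
  rcases h3 with h3 | h3
  · have := hf.integral_eq_one
    rw [show f = fun _ => f 0 from funext h2, h3] at this
    simp at this
  · exact absurd h3.1 (by simp)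

end FiniteInfo

end IsACDensity

lemma fisherInfo_eq_top {μ : Measure ℝ} (h : ¬ HasACDensity μ) : fisherInfo μ = ∞ := by
  unfold fisherInfo
  simp only [iInf_eq_top]
  exact fun f hf => absurd ⟨f, hf⟩ h

/-! ### Score of a convolution -/

/-- The convolution `x ↦ ∫ f (x - w) dν(w)` of a function with a measure. -/
noncomputable def convFun (f : ℝ → ℝ) (ν : Measure ℝ) (x : ℝ) : ℝ := ∫ w, f (x - w) ∂ν

section convFun

variable {ν : Measure ℝ} [IsProbabilityMeasure ν] {h : ℝ → ℝ}

lemma integrable_comp_sub (hm : Measurable h) (hh : Integrable h) :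
    Integrable (fun p : ℝ × ℝ => h (p.1 - p.2)) ((volume : Measure ℝ).prod ν) := by
  rw [integrable_prod_iff' (by exact (hm.comp (by fun_prop)).aestronglyMeasurable)]
  refine ⟨Eventually.of_forall fun y => hh.comp_sub_right y, ?_⟩
  have : ∀ y, ∫ x, ‖h (x - y)‖ = ∫ x, ‖h x‖ :=
    fun y => integral_sub_right_eq_self (fun x => ‖h x‖) y
  simp only [this]
  exact integrable_const _

lemma integrable_convFun (hm : Measurable h) (hh : Integrable h) : Integrable (convFun h ν) :=
  (integrable_comp_sub hm hh).integral_prod_left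

lemma ae_integrable_comp_sub (hm : Measurable h) (hh : Integrable h) :
    ∀ᵐ x, Integrable (fun w => h (x - w)) ν :=
  (integrable_comp_sub hm hh).prod_right_ae

lemma intervalIntegral_convFun (hm : Measurable h) (hh : Integrable h) (a b : ℝ) :
    ∫ x in a..b, convFun h ν x = ∫ w, (∫ x in a..b, h (x - w)) ∂ν := by
  unfold convFun
  refine intervalIntegral_integral_swap (f := fun x w => h (x - w)) ?_
  exact (integrable_comp_sub (ν := ν) hm hh).mono_measure
    (Measure.prod_mono Measure.restrict_le_self le_rfl)

end convFun

namespace IsACDensity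

variable {μ ν : Measure ℝ} {f : ℝ → ℝ} [IsProbabilityMeasure μ] [IsProbabilityMeasure ν]

lemma integrable_comp_sub_left (hf : IsACDensity μ f) (hI : fisherInfo μ ≠ ∞) (x : ℝ) :
    Integrable (fun w => f (x - w)) ν := by
  obtain ⟨K, hK⟩ := hf.exists_bound hI
  have := hf.continuous
  exact Integrable.of_bound (by fun_prop) K (Eventually.of_forall fun w => hK _)

lemma convFun_eq (hf : IsACDensity μ f) (hI : fisherInfo μ ≠ ∞) (a x : ℝ) :
    convFun f ν x = convFun f ν a + ∫ t in a..x, convFun (deriv f) ν t := by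
  rw [intervalIntegral_convFun (measurable_deriv f) (hf.integrable_deriv hI)]
  have : ∀ w, ∫ t in a..x, deriv f (t - w) = f (x - w) - f (a - w) := fun w => by
    rw [intervalIntegral.integral_comp_sub_right (deriv f), hf.integral_deriv]
  rw [integral_congr_ae (μ := ν) (Eventually.of_forall this),
    integral_sub (hf.integrable_comp_sub_left hI x) (hf.integrable_comp_sub_left hI a)]
  unfold convFun
  ring

/-- The convolution of a density of finite Fisher information with a probability measure is the
integral of the convolution of the derivative, hence it is absolutely continuous. -/
lemma conv (hf : IsACDensity μ f) (hI : fisherInfo μ ≠ ∞) : IsACDensity (μ ∗ ν) (convFun f ν) := by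
  have hc := hf.continuous
  refine ⟨fun x => integral_nonneg fun w => hf.1 _, fun a b => ?_, ?_⟩
  · have h1 := ((integrable_convFun (ν := ν) (measurable_deriv f)
      (hf.integrable_deriv hI)).intervalIntegrable (a := a) (b := b)
      ).absolutelyContinuousOnInterval_intervalIntegral (c := a) Set.left_mem_uIcc
    have h2 : AbsolutelyContinuousOnInterval (fun _ : ℝ => convFun f ν a) a b :=
      (LipschitzWith.const (convFun f ν a)).lipschitzOnWith.absolutelyContinuousOnInterval
    rw [funext (hf.convFun_eq (ν := ν) hI a)]
    exact h2.fun_add h1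
  · ext B hB
    have hB1 : Measurable (B.indicator (fun _ => (1 : ℝ≥0∞))) := measurable_const.indicator hB
    rw [← lintegral_indicator_one hB, withDensity_apply _ hB, ← lintegral_indicator hB,
      Measure.conv, lintegral_map (by exact hB1) (by fun_prop),
      lintegral_prod_symm _ (by exact (hB1.comp (by fun_prop)).aemeasurable)]
    have e1 : ∀ w, ∫⁻ z, B.indicator 1 (z + w) ∂μ
        = ∫⁻ t, B.indicator (fun t => ENNReal.ofReal (f (t - w))) t := by
      intro w
      rw [hf.lintegral_eq _ (by exact (hB1.comp (by fun_prop)).aemeasurable),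
        ← lintegral_sub_right_eq_self _ w]
      congr 1
      ext t
      by_cases ht : t ∈ B <;> simp [ht]
    have e2 : ∀ t, B.indicator (fun x => ENNReal.ofReal (convFun f ν x)) t
        = ∫⁻ w, B.indicator (fun t => ENNReal.ofReal (f (t - w))) t ∂ν := by
      intro t
      by_cases ht : t ∈ B
      · simp only [ht, Set.indicator_of_mem]
        exact ofReal_integral_eq_lintegral_ofReal (hf.integrable_comp_sub_left hI t)
          (Eventually.of_forall fun w => hf.1 _)
      · simp [ht]
    simp only [e1, e2]
    refine lintegral_lintegral_swap ?_
    have : (Function.uncurry fun (w t : ℝ) => B.indicator (fun t => ENNReal.ofReal (f (t - w))) t)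
        = (Prod.snd ⁻¹' B).indicator (fun p : ℝ × ℝ => ENNReal.ofReal (f (p.2 - p.1))) := by
      ext p
      rfl
    rw [this]
    exact (Measurable.indicator (by fun_prop) (measurable_snd hB)).aemeasurable

lemma ae_deriv_convFun (hf : IsACDensity μ f) (hI : fisherInfo μ ≠ ∞) :
    ∀ᵐ x, deriv (convFun f ν) x = convFun (deriv f) ν x := by
  filter_upwards [LocallyIntegrable.ae_hasDerivAt_integral (integrable_convFun (ν := ν)
    (measurable_deriv f) (hf.integrable_deriv hI)).locallyIntegrable] with x hx
  have := (hx 0).const_add (convFun f ν 0)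
  rw [← funext (hf.convFun_eq (ν := ν) hI 0)] at this
  exact this.deriv

/-- Adding an independent variable does not make a finite Fisher information infinite: the squared
score of the convolution, times its density, is at most the convolution of `f * score f ^ 2`. -/
lemma memLp_score_conv (hf : IsACDensity μ f) (hI : fisherInfo μ ≠ ∞) :
    MemLp (score (convFun f ν)) 2 (μ ∗ ν) := by
  have hF := hf.conv (ν := ν) hI
  have hms := hf.measurable_score
  have hc := hf.continuous
  rw [memLp_two_iff_integrable_sq hF.measurable_score.aestronglyMeasurable, hF.integrable_iff]
  have hq : Integrable (fun x => f x * score f x ^ 2) :=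
    (hf.integrable_iff _).1 (hf.memLp_score hI).integrable_sq
  have hqm : Measurable (fun x => f x * score f x ^ 2) := by fun_prop
  refine (integrable_convFun (ν := ν) hqm hq).mono' (by
    have := hF.measurable_score
    have := hF.continuous
    fun_prop) ?_
  filter_upwards [hf.ae_deriv_convFun (ν := ν) hI, ae_integrable_comp_sub (ν := ν) hqm hq,
    ae_integrable_comp_sub (ν := ν) (measurable_deriv f) (hf.integrable_deriv hI)] with x h1 h2 h3
  rw [Real.norm_of_nonneg (mul_nonneg (hF.1 x) (sq_nonneg _))]
  -- The Cauchy–Schwarz inequality, from `0 ≤ ∫ f (x - w) (score f (x - w) - l) ^ 2 dν(w)`.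
  set l := score (convFun f ν) x with hl
  have h4 : 0 ≤ ∫ w, f (x - w) * (score f (x - w) - l) ^ 2 ∂ν :=
    integral_nonneg fun w => mul_nonneg (hf.1 _) (sq_nonneg _)
  have h5 : ∫ w, f (x - w) * (score f (x - w) - l) ^ 2 ∂ν
      = convFun (fun x => f x * score f x ^ 2) ν x - 2 * l * convFun (deriv f) ν x
        + l ^ 2 * convFun f ν x := by
    unfold convFun
    rw [← integral_const_mul, ← integral_const_mul, ← integral_sub h2 (h3.const_mul _)]
    refine Eq.trans ?_ (integral_add (h2.sub (h3.const_mul (2 * l)))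
      ((hf.integrable_comp_sub_left hI x).const_mul (l ^ 2)))
    congr 1
    ext w
    simp only [hf.deriv_eq]
    ring
  have h6 := hF.deriv_eq x
  rw [h1, ← hl] at h6
  rw [h5, h6] at h4
  nlinarith

/-- The score of a sum `Z + W` of independent variables is the conditional expectation of the
score of `Z` given `Z + W`, in the form of a duality with the square integrable functions. -/
lemma integral_mul_score_conv (hf : IsACDensity μ f) (hI : fisherInfo μ ≠ ∞) {ψ : ℝ → ℝ}
    (hψm : Measurable ψ) (hψ : MemLp ψ 2 (μ ∗ ν)) :
    ∫ p : ℝ × ℝ, ψ (p.1 + p.2) * score f p.1 ∂(μ.prod ν)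
      = ∫ x, ψ x * score (convFun f ν) x ∂(μ ∗ ν) := by
  have hF := hf.conv (ν := ν) hI
  have hms := hf.measurable_score
  have hdm := measurable_deriv f
  have hmp : MeasurePreserving (fun p : ℝ × ℝ => p.1 + p.2) (μ.prod ν) (μ ∗ ν) :=
    ⟨by fun_prop, rfl⟩
  have h1 : Integrable (fun p : ℝ × ℝ => ψ (p.1 + p.2) * score f p.1) (μ.prod ν) :=
    (hψ.comp_measurePreserving hmp).integrable_mul
      ((hf.memLp_score hI).comp_measurePreserving measurePreserving_fst)
  have e1 : ∀ w z, f z * (ψ (z + w) * score f z) = ψ (z + w) * deriv f (z + w - w) := by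
    intro w z
    rw [add_sub_cancel_right, hf.deriv_eq]
    ring
  have h2 : Integrable (fun p : ℝ × ℝ => ψ p.1 * deriv f (p.1 - p.2))
      ((volume : Measure ℝ).prod ν) := by
    rw [integrable_prod_iff' (by fun_prop)]
    obtain ⟨h3, h4⟩ := (integrable_prod_iff' h1.aestronglyMeasurable).1 h1
    constructor
    · filter_upwards [h3] with w hw
      have := (hf.integrable_iff _).1 hw
      simp only [e1] at this
      simpa using this.comp_sub_right w
    · refine h4.congr (Eventually.of_forall fun w => ?_)
      simp only
      rw [hf.integral_eq, ← integral_add_right_eq_self (fun t => ‖ψ t * deriv f (t - w)‖) w]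
      congr 1
      ext z
      rw [← e1, norm_mul (f z), Real.norm_of_nonneg (hf.1 z)]
  rw [integral_prod_symm _ h1]
  have e2 : ∀ w, ∫ z, ψ (z + w) * score f z ∂μ = ∫ t, ψ t * deriv f (t - w) := by
    intro w
    rw [hf.integral_eq, ← integral_add_right_eq_self (fun t => ψ t * deriv f (t - w)) w]
    simp only [e1]
  simp only [e2]
  rw [← integral_integral_swap h2, hF.integral_eq]
  refine integral_congr_ae ?_
  filter_upwards [hf.ae_deriv_convFun (ν := ν) hI] with x hx
  rw [integral_const_mul, show ∫ w, deriv f (x - w) ∂ν = convFun (deriv f) ν x from rfl, ← hx,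
    hF.deriv_eq]
  ring

end IsACDensity

/-! ### Averages over coordinates and the variance drop inequality -/

section VarianceDrop

variable {ι α : Type*} [Fintype ι] [DecidableEq ι] [MeasurableSpace α] {μ : ι → Measure α}
  [∀ i, IsProbabilityMeasure (μ i)]

omit [Fintype ι] in
lemma measurable_piecewise_prod (A : Finset ι) :
    Measurable (fun p : (ι → α) × (ι → α) => A.piecewise p.2 p.1) := by
  rw [measurable_pi_iff]
  intro i
  by_cases hi : i ∈ A
  · simp only [hi, Finset.piecewise_eq_of_mem]; fun_prop
  · simp only [hi, not_false_eq_true, Finset.piecewise_eq_of_notMem]; fun_prop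

/-- Exchanging the coordinates in `A` between two independent samples does not change their joint
law. -/
lemma measurePreserving_exchange (A : Finset ι) :
    MeasurePreserving
      (fun p : (ι → α) × (ι → α) => (A.piecewise p.2 p.1, A.piecewise p.1 p.2))
      ((Measure.pi μ).prod (Measure.pi μ)) ((Measure.pi μ).prod (Measure.pi μ)) := by
  have h1 := measurePreserving_arrowProdEquivProdArrow α α ι μ μ
  have h2 : MeasurePreserving
      (fun (g : ι → α × α) i => (if i ∈ A then Prod.swap else id) (g i))
      (Measure.pi fun i => (μ i).prod (μ i)) (Measure.pi fun i => (μ i).prod (μ i)) := by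
    refine measurePreserving_pi _ _ fun i => ?_
    split_ifs
    · exact Measure.measurePreserving_swap
    · exact MeasurePreserving.id _
  convert h1.comp (h2.comp (h1.symm _)) using 1
  ext p i
  · by_cases hi : i ∈ A <;>
      simp [hi, MeasurableEquiv.arrowProdEquivProdArrow, Equiv.arrowProdEquivProdArrow]
  · by_cases hi : i ∈ A <;>
      simp [hi, MeasurableEquiv.arrowProdEquivProdArrow, Equiv.arrowProdEquivProdArrow]

lemma measurePreserving_piecewise (A : Finset ι) :
    MeasurePreserving (fun p : (ι → α) × (ι → α) => A.piecewise p.2 p.1)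
      ((Measure.pi μ).prod (Measure.pi μ)) (Measure.pi μ) :=
  measurePreserving_fst.comp (measurePreserving_exchange (μ := μ) A)

/-- The average of `ψ` over the coordinates in `A`, that is, the conditional expectation of `ψ`
given the coordinates outside `A`. The integral is over all coordinates of `y`, but only those in
`A` enter. -/
noncomputable def avgOut (μ : ι → Measure α) (A : Finset ι) (ψ : (ι → α) → ℝ) (x : ι → α) : ℝ :=
  ∫ y, ψ (A.piecewise y x) ∂(Measure.pi μ)

lemma measurable_avgOut (A : Finset ι) {ψ : (ι → α) → ℝ} (hψ : Measurable ψ) :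
    Measurable (avgOut μ A ψ) :=
  (StronglyMeasurable.integral_prod_right (f := fun x y => ψ (A.piecewise y x))
    (hψ.comp (measurable_piecewise_prod A)).stronglyMeasurable).measurable

omit [∀ i, IsProbabilityMeasure (μ i)] in
lemma dependsOn_avgOut (A S : Finset ι) {ψ : (ι → α) → ℝ} (hψ : DependsOn ψ (S : Set ι)) :
    DependsOn (avgOut μ A ψ) ((S \ A : Finset ι) : Set ι) := by
  intro x x' h
  unfold avgOut
  congr 1
  ext y
  refine hψ fun i hi => ?_
  by_cases hA : i ∈ A
  · simp [hA]
  · simp only [hA, not_false_eq_true, Finset.piecewise_eq_of_notMem]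
    exact h i (by simpa [hA] using hi)

lemma avgOut_eq_self (A S : Finset ι) {ψ : (ι → α) → ℝ} (hψ : DependsOn ψ (S : Set ι))
    (hAS : Disjoint A S) : avgOut μ A ψ = ψ := by
  ext x
  have : ∀ y, ψ (A.piecewise y x) = ψ x := fun y => hψ fun i hi => by
    rw [Finset.piecewise_eq_of_notMem]
    exact fun h => Finset.disjoint_left.1 hAS h hi
  simp [avgOut, this]

omit [∀ i, IsProbabilityMeasure (μ i)] in
lemma avgOut_piecewise (A : Finset ι) (ψ : (ι → α) → ℝ) (x y : ι → α) :
    avgOut μ A ψ (A.piecewise y x) = avgOut μ A ψ x := by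
  unfold avgOut
  congr 1
  ext z
  congr 1
  ext i
  by_cases hA : i ∈ A <;> simp [hA]

section

variable {A : Finset ι} {ψ : (ι → α) → ℝ}

lemma integrable_piecewise {h : (ι → α) → ℝ} (hh : Integrable h (Measure.pi μ)) :
    Integrable (fun p : (ι → α) × (ι → α) => h (A.piecewise p.2 p.1))
      ((Measure.pi μ).prod (Measure.pi μ)) :=
  (measurePreserving_piecewise A).integrable_comp_of_integrable hh

lemma integral_piecewise {h : (ι → α) → ℝ} (hh : Integrable h (Measure.pi μ)) :
    ∫ x, ∫ y, h (A.piecewise y x) ∂(Measure.pi μ) ∂(Measure.pi μ) = ∫ x, h x ∂(Measure.pi μ) := by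
  have h1 := integral_prod _ (integrable_piecewise (A := A) hh)
  have h2 := measurePreserving_piecewise (μ := μ) A
  rw [← h1]
  conv_rhs => rw [← h2.map_eq]
  rw [integral_map h2.measurable.aemeasurable (by rw [h2.map_eq]; exact hh.aestronglyMeasurable)]

lemma integral_avgOut (hψ : Integrable ψ (Measure.pi μ)) :
    ∫ x, avgOut μ A ψ x ∂(Measure.pi μ) = ∫ x, ψ x ∂(Measure.pi μ) :=
  integral_piecewise hψ

lemma ae_memLp_piecewise (hψ : MemLp ψ 2 (Measure.pi μ)) (hm : Measurable ψ) :
    ∀ᵐ x ∂(Measure.pi μ), MemLp (fun y => ψ (A.piecewise y x)) 2 (Measure.pi μ) := by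
  filter_upwards [(integrable_piecewise (A := A) hψ.integrable_sq).prod_right_ae] with x hx
  rw [memLp_two_iff_integrable_sq]
  · exact hx
  · exact ((hm.comp (measurable_piecewise_prod A)).comp measurable_prodMk_left).aestronglyMeasurable

/-- The fibrewise identity between variance, second moment and mean. -/
lemma ae_integral_sub_avgOut_sq (hψ : MemLp ψ 2 (Measure.pi μ)) (hm : Measurable ψ) :
    ∀ᵐ x ∂(Measure.pi μ), ∫ y, (ψ (A.piecewise y x) - avgOut μ A ψ x) ^ 2 ∂(Measure.pi μ)
      = ∫ y, ψ (A.piecewise y x) ^ 2 ∂(Measure.pi μ) - avgOut μ A ψ x ^ 2 := by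
  filter_upwards [ae_memLp_piecewise (A := A) hψ hm] with x hx
  have h1 := hx.integrable_sq
  have h2 : Integrable (fun y => ψ (A.piecewise y x)) (Measure.pi μ) := hx.integrable (by norm_num)
  set m := avgOut μ A ψ x with hmdef
  have : ∀ y, (ψ (A.piecewise y x) - m) ^ 2
      = ψ (A.piecewise y x) ^ 2 - 2 * m * ψ (A.piecewise y x) + m ^ 2 := fun y => by ring
  simp only [this]
  refine (integral_add (h1.sub (h2.const_mul (2 * m))) (integrable_const (m ^ 2))).trans ?_
  have h3 : ∫ y, (ψ (A.piecewise y x) ^ 2 - 2 * m * ψ (A.piecewise y x)) ∂(Measure.pi μ)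
      = ∫ y, ψ (A.piecewise y x) ^ 2 ∂(Measure.pi μ) - 2 * m * m := by
    rw [integral_sub h1 (h2.const_mul _), integral_const_mul]
    rfl
  simp only [Pi.sub_apply, h3, integral_const, probReal_univ, one_smul]
  ring

lemma memLp_avgOut (hψ : MemLp ψ 2 (Measure.pi μ)) (hm : Measurable ψ) :
    MemLp (avgOut μ A ψ) 2 (Measure.pi μ) := by
  rw [memLp_two_iff_integrable_sq (measurable_avgOut A hm).aestronglyMeasurable]
  refine (integrable_piecewise (A := A) hψ.integrable_sq).integral_prod_left.mono'
    ((measurable_avgOut A hm).pow_const 2).aestronglyMeasurable ?_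
  filter_upwards [ae_integral_sub_avgOut_sq (A := A) hψ hm] with x hx
  rw [Real.norm_of_nonneg (sq_nonneg _)]
  have : 0 ≤ ∫ y, (ψ (A.piecewise y x) - avgOut μ A ψ x) ^ 2 ∂(Measure.pi μ) :=
    integral_nonneg fun y => sq_nonneg _
  linarith

lemma integrable_sub_avgOut_sq (hψ : MemLp ψ 2 (Measure.pi μ)) (hm : Measurable ψ) :
    Integrable (fun x => (ψ x - avgOut μ A ψ x) ^ 2) (Measure.pi μ) :=
  (hψ.sub (memLp_avgOut hψ hm)).integrable_sq

/-- Pythagoras for the orthogonal projection `avgOut μ A`. -/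
lemma integral_sq_eq_add (hψ : MemLp ψ 2 (Measure.pi μ)) (hm : Measurable ψ) :
    ∫ x, ψ x ^ 2 ∂(Measure.pi μ) = ∫ x, (ψ x - avgOut μ A ψ x) ^ 2 ∂(Measure.pi μ)
      + ∫ x, avgOut μ A ψ x ^ 2 ∂(Measure.pi μ) := by
  have h1 := memLp_avgOut (A := A) hψ hm
  rw [← integral_piecewise (A := A) (integrable_sub_avgOut_sq (A := A) hψ hm),
    ← integral_piecewise (A := A) hψ.integrable_sq, ← integral_add]
  · refine integral_congr_ae ?_
    filter_upwards [ae_integral_sub_avgOut_sq (A := A) hψ hm] with x hx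
    simp only [avgOut_piecewise]
    rw [hx]
    ring
  · exact (integrable_piecewise (A := A) (integrable_sub_avgOut_sq hψ hm)).integral_prod_left
  · exact h1.integrable_sq

lemma ae_avgOut_sum {κ : Type*} (s : Finset κ) {φ : κ → (ι → α) → ℝ}
    (hφ : ∀ a ∈ s, MemLp (φ a) 2 (Measure.pi μ)) (hm : ∀ a ∈ s, Measurable (φ a)) :
    ∀ᵐ x ∂(Measure.pi μ),
      avgOut μ A (fun x => ∑ a ∈ s, φ a x) x = ∑ a ∈ s, avgOut μ A (φ a) x := by
  have : ∀ᵐ x ∂(Measure.pi μ), ∀ a ∈ s,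
      MemLp (fun y => φ a (A.piecewise y x)) 2 (Measure.pi μ) :=
    (ae_ball_iff s.countable_toSet).2 fun a ha => ae_memLp_piecewise (hφ a ha) (hm a ha)
  filter_upwards [this] with x hx
  exact integral_finsetSum _ fun a ha => (hx a ha).integrable (by norm_num)

/-- If `R` does not depend on each single coordinate in `A`, up to null sets, then it does not
depend on all of them jointly. -/
lemma ae_piecewise_eq {R : (ι → α) → ℝ} (A : Finset ι)
    (h : ∀ i ∈ A, ∀ᵐ x ∂(Measure.pi μ), R x = avgOut μ {i} R x) :
    ∀ᵐ p ∂((Measure.pi μ).prod (Measure.pi μ)), R (A.piecewise p.2 p.1) = R p.1 := by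
  have h1 : ∀ i ∈ A, ∀ᵐ p ∂((Measure.pi μ).prod (Measure.pi μ)),
      R (({i} : Finset ι).piecewise p.2 p.1) = R p.1 := by
    intro i hi
    filter_upwards [(measurePreserving_piecewise (μ := μ) {i}).quasiMeasurePreserving.ae (h i hi),
      Measure.quasiMeasurePreserving_fst.ae (h i hi)] with p hp1 hp2
    rw [hp1, avgOut_piecewise, ← hp2]
  induction A using Finset.induction_on with
  | empty => simp
  | insert i A hiA ih =>
    have ih' := ih (fun j hj => h j (Finset.mem_insert_of_mem hj))
      fun j hj => h1 j (Finset.mem_insert_of_mem hj)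
    filter_upwards [ih', (measurePreserving_exchange (μ := μ) A).quasiMeasurePreserving.ae
      (h1 i (Finset.mem_insert_self i A))] with p hp1 hp2
    rw [hp1] at hp2
    rw [← hp2]
    congr 1
    ext j
    by_cases hj : j = i
    · subst hj; simp [hiA]
    · by_cases hjA : j ∈ A <;> simp [hj, hjA]

end

section Family

variable {κ : Type*} {s : Finset κ} {ψ : κ → (ι → α) → ℝ} {S : κ → Finset ι} {r : ℕ}

/-- The part of a sum that depends on the coordinate `i` comes from the summands which involve
this coordinate, at most `r` in number. -/
lemma ae_sq_sub_avgOut_le (hm : ∀ a ∈ s, Measurable (ψ a))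
    (h2 : ∀ a ∈ s, MemLp (ψ a) 2 (Measure.pi μ))
    (hdep : ∀ a ∈ s, DependsOn (ψ a) (S a : Set ι)) (hr : ∀ i, (s.filter (i ∈ S ·)).card ≤ r)
    (i : ι) :
    ∀ᵐ x ∂(Measure.pi μ), (∑ a ∈ s, ψ a x - avgOut μ {i} (fun x => ∑ a ∈ s, ψ a x) x) ^ 2
      ≤ r * ∑ a ∈ s, (ψ a x - avgOut μ {i} (ψ a) x) ^ 2 ∧
      ((∑ a ∈ s, ψ a x - avgOut μ {i} (fun x => ∑ a ∈ s, ψ a x) x) ^ 2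
        = r * ∑ a ∈ s, (ψ a x - avgOut μ {i} (ψ a) x) ^ 2 → ∀ b ∈ s, i ∈ S b →
        ∑ a ∈ s, ψ a x - avgOut μ {i} (fun x => ∑ a ∈ s, ψ a x) x
          = r * (ψ b x - avgOut μ {i} (ψ b) x)) := by
  filter_upwards [ae_avgOut_sum (A := {i}) s h2 hm] with x hx
  have h0 : ∀ a ∈ s, i ∉ S a → ψ a x - avgOut μ {i} (ψ a) x = 0 := fun a ha hi => by
    rw [avgOut_eq_self {i} (S a) (hdep a ha) (by simpa using hi), sub_self]
  rw [hx, ← Finset.sum_sub_distrib]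
  set u : κ → ℝ := fun a => ψ a x - avgOut μ {i} (ψ a) x with hu
  set K := s.filter (i ∈ S ·) with hK
  have e1 : ∑ a ∈ s, u a = ∑ a ∈ K, u a :=
    (Finset.sum_filter_of_ne fun a ha hne => not_not.1 fun hi => hne (h0 a ha hi)).symm
  have e2 : ∑ a ∈ s, u a ^ 2 = ∑ a ∈ K, u a ^ 2 :=
    (Finset.sum_filter_of_ne fun a ha hne => not_not.1 fun hi => hne (by
      rw [show u a = 0 from h0 a ha hi]; simp)).symm
  have hKr : (K.card : ℝ) ≤ r := by exact_mod_cast hr i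
  change (∑ a ∈ s, u a) ^ 2 ≤ r * ∑ a ∈ s, u a ^ 2 ∧
    ((∑ a ∈ s, u a) ^ 2 = r * ∑ a ∈ s, u a ^ 2 → ∀ b ∈ s, i ∈ S b → ∑ a ∈ s, u a = r * u b)
  rw [e1, e2]
  refine ⟨(sq_sum_le_card_mul_sum_sq).trans
    (mul_le_mul_of_nonneg_right hKr (Finset.sum_nonneg fun a _ => sq_nonneg _)),
    fun heq b hb hi => ?_⟩
  set D := ∑ a ∈ K, u a with hD
  have h3 : ∑ a ∈ K, (D - r * u a) ^ 2 = (K.card - r) * D ^ 2 := by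
    have : ∀ a, (D - r * u a) ^ 2 = D ^ 2 - 2 * r * D * u a + r ^ 2 * u a ^ 2 := fun a => by ring
    simp only [this, Finset.sum_add_distrib, Finset.sum_sub_distrib, ← Finset.mul_sum, ← hD,
      Finset.sum_const, nsmul_eq_mul]
    linear_combination (-(r : ℝ)) * heq
  have h4 : (D - r * u b) ^ 2 ≤ ∑ a ∈ K, (D - r * u a) ^ 2 :=
    Finset.single_le_sum (f := fun a => (D - r * u a) ^ 2) (fun a _ => sq_nonneg _)
      (Finset.mem_filter.2 ⟨hb, hi⟩)
  have h5 : (D - r * u b) ^ 2 ≤ 0 := by nlinarith [sq_nonneg D]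
  have h6 : D - r * u b = 0 := pow_eq_zero_iff (two_ne_zero) |>.1 (le_antisymm h5 (sq_nonneg _))
  linarith

lemma integrable_sum_sq_sub_avgOut (hm : ∀ a ∈ s, Measurable (ψ a))
    (h2 : ∀ a ∈ s, MemLp (ψ a) 2 (Measure.pi μ)) (A : Finset ι) :
    Integrable (fun x => (r : ℝ) * ∑ a ∈ s, (ψ a x - avgOut μ A (ψ a) x) ^ 2) (Measure.pi μ) :=
  (integrable_finsetSum _ fun a ha =>
    integrable_sub_avgOut_sq (h2 a ha) (hm a ha)).const_mul _

lemma integral_sum_sq_sub_avgOut (hm : ∀ a ∈ s, Measurable (ψ a))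
    (h2 : ∀ a ∈ s, MemLp (ψ a) 2 (Measure.pi μ)) (A : Finset ι) :
    ∫ x, (r : ℝ) * ∑ a ∈ s, (ψ a x - avgOut μ A (ψ a) x) ^ 2 ∂(Measure.pi μ)
      = r * ∑ a ∈ s, (∫ x, ψ a x ^ 2 ∂(Measure.pi μ)
        - ∫ x, avgOut μ A (ψ a) x ^ 2 ∂(Measure.pi μ)) := by
  rw [integral_const_mul, integral_finsetSum _ fun a ha =>
    integrable_sub_avgOut_sq (h2 a ha) (hm a ha)]
  congr 1
  refine Finset.sum_congr rfl fun a ha => ?_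
  rw [integral_sq_eq_add (A := A) (h2 a ha) (hm a ha)]
  simp

/-- **Variance drop inequality**: if every coordinate occurs in at most `r` of the sets `S a`, then
the variance of a sum of centred functions `ψ a` of the coordinates in `S a` is at most `r` times
the sum of the variances. The set `B` of the coordinates in use is there for the induction. -/
theorem variance_drop (B : Finset ι) (hS : ∀ a ∈ s, S a ⊆ B) (hm : ∀ a ∈ s, Measurable (ψ a))
    (h2 : ∀ a ∈ s, MemLp (ψ a) 2 (Measure.pi μ))
    (hdep : ∀ a ∈ s, DependsOn (ψ a) (S a : Set ι)) (hr : ∀ i, (s.filter (i ∈ S ·)).card ≤ r)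
    (hmean : ∀ a ∈ s, ∫ x, ψ a x ∂(Measure.pi μ) = 0) :
    ∫ x, (∑ a ∈ s, ψ a x) ^ 2 ∂(Measure.pi μ) ≤ r * ∑ a ∈ s, ∫ x, ψ a x ^ 2 ∂(Measure.pi μ) := by
  induction B using Finset.induction_on generalizing ψ S with
  | empty =>
    have : ∀ a ∈ s, ∀ x, ψ a x = 0 := by
      intro a ha x
      have h1 : ∀ y, ψ a y = ψ a x := fun y => hdep a ha (by
        rw [Finset.subset_empty.1 (hS a ha)]; simp)
      have h3 := hmean a ha
      simpa [h1] using h3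
    have h3 : ∀ x, ∑ a ∈ s, ψ a x = 0 := fun x => Finset.sum_eq_zero fun a ha => this a ha x
    simp only [h3]
    simp only [ne_eq, OfNat.ofNat_ne_zero, not_false_eq_true, zero_pow, integral_zero]
    exact mul_nonneg (by positivity) (Finset.sum_nonneg fun a _ => integral_nonneg fun x =>
      sq_nonneg _)
  | insert i B hiB ih =>
    have hΨm : Measurable (fun x => ∑ a ∈ s, ψ a x) := Finset.measurable_fun_sum _ hm
    have hΨ2 : MemLp (fun x => ∑ a ∈ s, ψ a x) 2 (Measure.pi μ) := memLp_finsetSum s h2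
    have h3 := ih (ψ := fun a => avgOut μ {i} (ψ a)) (S := fun a => S a \ {i})
      (fun a ha j hj => by
        have := hS a ha (Finset.mem_sdiff.1 hj).1
        have h4 := (Finset.mem_sdiff.1 hj).2
        simp only [Finset.mem_singleton, Finset.mem_insert] at this h4
        tauto)
      (fun a ha => measurable_avgOut _ (hm a ha))
      (fun a ha => memLp_avgOut (h2 a ha) (hm a ha))
      (fun a ha => dependsOn_avgOut _ _ (hdep a ha))
      (fun j => (Finset.card_le_card (Finset.monotone_filter_right _ fun a _ h =>
        (Finset.mem_sdiff.1 h).1)).trans (hr j))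
      (fun a ha => by
        rw [integral_avgOut ((h2 a ha).integrable (by norm_num)), hmean a ha])
    have h4 : ∫ x, avgOut μ {i} (fun x => ∑ a ∈ s, ψ a x) x ^ 2 ∂(Measure.pi μ)
        = ∫ x, (∑ a ∈ s, avgOut μ {i} (ψ a) x) ^ 2 ∂(Measure.pi μ) := by
      refine integral_congr_ae ?_
      filter_upwards [ae_avgOut_sum (A := {i}) s h2 hm] with x hx
      rw [hx]
    have h5 := integral_mono_ae (integrable_sub_avgOut_sq (A := {i}) hΨ2 hΨm)
      (integrable_sum_sq_sub_avgOut (r := r) hm h2 {i})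
      (by filter_upwards [ae_sq_sub_avgOut_le hm h2 hdep hr i] with x hx using hx.1)
    rw [integral_sum_sq_sub_avgOut hm h2, Finset.sum_sub_distrib] at h5
    rw [integral_sq_eq_add (A := {i}) hΨ2 hΨm, h4]
    linarith

/-- Equality in the variance drop inequality: the part of the sum which depends on the coordinate
`i` is `r` times the corresponding part of every `ψ b` with `i ∈ S b`. -/
theorem variance_drop_eq (hm : ∀ a ∈ s, Measurable (ψ a))
    (h2 : ∀ a ∈ s, MemLp (ψ a) 2 (Measure.pi μ))
    (hdep : ∀ a ∈ s, DependsOn (ψ a) (S a : Set ι)) (hr : ∀ i, (s.filter (i ∈ S ·)).card ≤ r)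
    (hmean : ∀ a ∈ s, ∫ x, ψ a x ∂(Measure.pi μ) = 0)
    (heq : ∫ x, (∑ a ∈ s, ψ a x) ^ 2 ∂(Measure.pi μ)
      = r * ∑ a ∈ s, ∫ x, ψ a x ^ 2 ∂(Measure.pi μ)) {b : κ} (hb : b ∈ s) {i : ι} (hi : i ∈ S b) :
    ∀ᵐ x ∂(Measure.pi μ), ∑ a ∈ s, ψ a x - avgOut μ {i} (fun x => ∑ a ∈ s, ψ a x) x
      = r * (ψ b x - avgOut μ {i} (ψ b) x) := by
  have hΨm : Measurable (fun x => ∑ a ∈ s, ψ a x) := Finset.measurable_fun_sum _ hm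
  have hΨ2 : MemLp (fun x => ∑ a ∈ s, ψ a x) 2 (Measure.pi μ) := memLp_finsetSum s h2
  have h3 := variance_drop Finset.univ (fun a _ => Finset.subset_univ _)
    (fun a ha => measurable_avgOut {i} (hm a ha))
    (fun a ha => memLp_avgOut (h2 a ha) (hm a ha))
    (fun a ha => (dependsOn_avgOut {i} _ (hdep a ha)).mono
      (Finset.coe_subset.2 Finset.sdiff_subset)) hr
    (fun a ha => by rw [integral_avgOut ((h2 a ha).integrable (by norm_num)), hmean a ha])
  have h4 : ∫ x, avgOut μ {i} (fun x => ∑ a ∈ s, ψ a x) x ^ 2 ∂(Measure.pi μ)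
      = ∫ x, (∑ a ∈ s, avgOut μ {i} (ψ a) x) ^ 2 ∂(Measure.pi μ) := by
    refine integral_congr_ae ?_
    filter_upwards [ae_avgOut_sum (A := {i}) s h2 hm] with x hx
    rw [hx]
  have i1 := integrable_sub_avgOut_sq (A := {i}) hΨ2 hΨm
  have i2 := integrable_sum_sq_sub_avgOut (r := r) hm h2 {i}
  have h5 := ae_sq_sub_avgOut_le hm h2 hdep hr i
  have h6 := integral_sum_sq_sub_avgOut (r := r) hm h2 {i}
  have h7 := integral_sq_eq_add (A := {i}) hΨ2 hΨm
  rw [Finset.sum_sub_distrib] at h6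
  have h8 : ∫ x, ((r : ℝ) * ∑ a ∈ s, (ψ a x - avgOut μ {i} (ψ a) x) ^ 2
      - (∑ a ∈ s, ψ a x - avgOut μ {i} (fun x => ∑ a ∈ s, ψ a x) x) ^ 2) ∂(Measure.pi μ) ≤ 0 := by
    rw [integral_sub i2 i1]
    linarith
  have h9 : 0 ≤ᵐ[Measure.pi μ] fun x => (r : ℝ) * ∑ a ∈ s, (ψ a x - avgOut μ {i} (ψ a) x) ^ 2
      - (∑ a ∈ s, ψ a x - avgOut μ {i} (fun x => ∑ a ∈ s, ψ a x) x) ^ 2 := by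
    filter_upwards [h5] with x hx
    exact sub_nonneg.2 hx.1
  have h10 := (integral_eq_zero_iff_of_nonneg_ae h9 (i2.sub i1)).1
    (le_antisymm h8 (integral_nonneg_of_ae h9))
  filter_upwards [h5, h10] with x hx hx0
  exact hx.2 (sub_eq_zero.1 hx0).symm b hb hi

end Family

end VarianceDrop

/-! ### Cramér's decomposition theorem for the normal law -/

/-- An entire function with at most quadratic growth is a quadratic polynomial. -/
lemma exists_quadratic_of_norm_le {g : ℂ → ℂ} (hg : Differentiable ℂ g) (h0 : g 0 = 0) {K : ℝ}
    (hK : ∀ z, ‖g z‖ ≤ K * (1 + ‖z‖) ^ 2) : ∃ b c : ℂ, ∀ z, g z = b * z + c * z ^ 2 / 2 := by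
  have hd : ∀ n, Differentiable ℂ (iteratedDeriv n g) := fun n =>
    (hg.contDiff (n := n + 1)).differentiable_iteratedDeriv n (by exact_mod_cast Nat.lt_succ_self n)
  have h3 : ∀ z, iteratedDeriv 3 g z = 0 := by
    intro z
    have hb : ∀ n : ℕ, ‖iteratedDeriv 3 g z‖
        ≤ 6 * (K * (2 + ‖z‖ + n) ^ 2) / (n + 1 : ℝ) ^ 3 := by
      intro n
      have := Complex.norm_iteratedDeriv_le_of_forall_mem_sphere_norm_le (c := z) (f := g) 3
        (R := n + 1) (C := K * (2 + ‖z‖ + n) ^ 2) (by positivity) hg.diffContOnCl ?_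
      · simpa [Nat.factorial] using this
      · intro w hw
        have hK0 : 0 ≤ K := by simpa [h0] using hK 0
        refine (hK w).trans (mul_le_mul_of_nonneg_left ?_ hK0)
        have hw' : ‖w - z‖ = n + 1 := by simpa using hw
        have : ‖w‖ ≤ ‖z‖ + (n + 1) := by
          calc ‖w‖ = ‖z + (w - z)‖ := by ring_nf
            _ ≤ _ := by rw [← hw']; exact norm_add_le _ _
        exact pow_le_pow_left₀ (by positivity) (by linarith) 2
    have hlim : Tendsto (fun n : ℕ => 6 * (K * (2 + ‖z‖ + n) ^ 2) / (n + 1 : ℝ) ^ 3) atTop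
        (𝓝 0) := by
      have e1 : Tendsto (fun n : ℕ => 1 / ((n : ℝ) + 1)) atTop (𝓝 0) :=
        tendsto_one_div_add_atTop_nhds_zero_nat
      have e2 := (((e1.const_mul (1 + ‖z‖)).add_const 1).pow 2).mul e1 |>.const_mul (6 * K)
      simp only [mul_zero, zero_add, one_pow] at e2
      refine e2.congr fun n => ?_
      have : (n : ℝ) + 1 ≠ 0 := by positivity
      field_simp
      ring
    have := ge_of_tendsto' hlim hb
    exact norm_eq_zero.1 (le_antisymm this (norm_nonneg _))
  have e2 : ∀ z, iteratedDeriv 2 g z = iteratedDeriv 2 g 0 := fun z =>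
    is_const_of_deriv_eq_zero (hd 2) (fun x => by rw [← iteratedDeriv_succ]; exact h3 x) z 0
  set c := iteratedDeriv 2 g 0 with hc
  have hd1 : ∀ z, HasDerivAt (deriv g) c z := fun z => by
    have := ((hd 1) z).hasDerivAt
    rw [← iteratedDeriv_succ, e2, iteratedDeriv_one] at this
    exact this
  have e1 : ∀ z, deriv g z = deriv g 0 + c * z := by
    intro z
    have h4 : ∀ x, HasDerivAt (fun x => deriv g x - c * x) 0 x := fun x =>
      ((hd1 x).sub ((hasDerivAt_id x).const_mul c)).congr_deriv (by simp)
    have := is_const_of_deriv_eq_zero (fun x => (h4 x).differentiableAt) (fun x => (h4 x).deriv) z 0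
    simp only [mul_zero, sub_zero] at this
    linear_combination this
  refine ⟨deriv g 0, c, fun z => ?_⟩
  have h4 : ∀ x, HasDerivAt (fun x => g x - (deriv g 0 * x + c * x ^ 2 / 2)) 0 x := fun x => by
    refine ((hg x).hasDerivAt.sub (((hasDerivAt_id x).const_mul (deriv g 0)).add
      (((hasDerivAt_pow 2 x).const_mul c).div_const 2))).congr_deriv ?_
    rw [e1 x]
    simp
    ring
  have := is_const_of_deriv_eq_zero (fun x => (h4 x).differentiableAt) (fun x => (h4 x).deriv) z 0
  simp only [h0] at this
  linear_combination this

/-- A zero-free entire function of order at most `2` is the exponential of a quadratic polynomial: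
the special case of Hadamard's factorization which Cramér's theorem needs. -/
lemma exists_exp_quadratic {φ : ℂ → ℂ} (hd : Differentiable ℂ φ) (h0 : ∀ z, φ z ≠ 0)
    (h1 : φ 0 = 1) {K : ℝ} (hK : 0 < K) (hb : ∀ z, ‖φ z‖ ≤ Real.exp (K * (1 + ‖z‖) ^ 2)) :
    ∃ b c : ℂ, ∀ z, φ z = Complex.exp (b * z + c * z ^ 2 / 2) := by
  have hd' : Differentiable ℂ (deriv φ) := by
    have := (hd.contDiff (n := 2)).differentiable_iteratedDeriv 1 (by norm_num)
    rwa [iteratedDeriv_one] at this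
  obtain ⟨g, hg0, hg⟩ := (hd'.div hd h0).isExactOn_univ.with_val_at 0 0
  have hgd : Differentiable ℂ g := fun z => (hg z trivial).differentiableAt
  have hφ : ∀ z, φ z = Complex.exp (g z) := by
    intro z
    have h4 : ∀ x, HasDerivAt (fun x => φ x * Complex.exp (-g x)) 0 x := fun x => by
      refine ((hd x).hasDerivAt.mul (hg x trivial).neg.cexp).congr_deriv ?_
      have := h0 x
      simp only [Pi.div_apply, Pi.neg_apply]
      field_simp
      ring
    have := is_const_of_deriv_eq_zero (fun x => (h4 x).differentiableAt) (fun x => (h4 x).deriv) z 0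
    simp only [h1, hg0, neg_zero, Complex.exp_zero, mul_one] at this
    rw [Complex.exp_neg] at this
    exact (mul_inv_eq_one₀ (Complex.exp_ne_zero _)).1 this
  have hre : ∀ z, (g z).re ≤ K * (1 + ‖z‖) ^ 2 := fun z => by
    have := hb z
    rwa [hφ z, Complex.norm_exp, Real.exp_le_exp] at this
  have hgb : ∀ z, ‖g z‖ ≤ (8 * K) * (1 + ‖z‖) ^ 2 := by
    intro z
    have hz0 := norm_nonneg z
    have := Complex.borelCaratheodory_zero (f := g) (z := z) (M := K * (1 + (2 * ‖z‖ + 1)) ^ 2)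
      (R := 2 * ‖z‖ + 1) (by positivity) hgd.differentiableOn (fun w hw => by
        refine (hre w).trans ?_
        have hw' : ‖w‖ < 2 * ‖z‖ + 1 := by simpa using hw
        gcongr) (by positivity) (by simp; linarith) hg0
    refine this.trans ?_
    rw [div_le_iff₀ (by linarith)]
    have h5 : 0 ≤ K * (1 + ‖z‖) ^ 2 := by positivity
    nlinarith
  obtain ⟨b, c, hbc⟩ := exists_quadratic_of_norm_le hgd hg0 hgb
  exact ⟨b, c, fun z => by rw [hφ, hbc]⟩

section Cramer

variable {μ ν : Measure ℝ} [IsProbabilityMeasure μ] [IsProbabilityMeasure ν]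

lemma integrable_exp_of_conv {t : ℝ} (h : Integrable (fun x => Real.exp (t * x)) (μ ∗ ν)) :
    Integrable (fun x => Real.exp (t * x)) μ := by
  have h1 : Integrable (fun p : ℝ × ℝ => Real.exp (t * (p.1 + p.2))) (μ.prod ν) :=
    (integrable_map_measure (f := fun p : ℝ × ℝ => p.1 + p.2)
      (g := fun x => Real.exp (t * x)) (by fun_prop) (by fun_prop)).1 h
  obtain ⟨y, hy⟩ := h1.prod_left_ae.exists
  refine (hy.mul_const (Real.exp (-(t * y)))).congr (Eventually.of_forall fun x => ?_)
  simp only [← Real.exp_add]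
  ring_nf

lemma complexMGF_conv (z : ℂ) :
    complexMGF id (μ ∗ ν) z = complexMGF id μ z * complexMGF id ν z := by
  unfold complexMGF
  rw [Measure.conv, integral_map (by fun_prop) (by fun_prop), ← integral_prod_mul]
  congr 1
  ext p
  simp only [id, ← Complex.exp_add]
  push_cast
  ring_nf

/-- Jensen's inequality for the moment generating function. -/
lemma exp_mean_le_mgf (h : ∀ t : ℝ, Integrable (fun x => Real.exp (t * x)) μ) (t : ℝ) :
    Real.exp (t * ∫ x, x ∂μ) ≤ mgf id μ t := by
  have hint : Integrable (fun x : ℝ => x) μ :=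
    integrable_of_mem_interior_integrableExpSet (X := id) (by
      rw [show integrableExpSet id μ = Set.univ from Set.eq_univ_of_forall h]; simp)
  set m := ∫ x, x ∂μ with hm
  have h1 : ∫ x, Real.exp (t * m) * (t * (x - m) + 1) ∂μ = Real.exp (t * m) := by
    have h2 : ∫ x, (x - m) ∂μ = 0 := by
      rw [integral_sub hint (integrable_const m)]
      simp [← hm]
    have h3 : Integrable (fun x => t * (x - m)) μ := (hint.sub (integrable_const m)).const_mul t
    rw [integral_const_mul, integral_add h3 (integrable_const _), integral_const_mul, h2]
    simp
  rw [← h1]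
  refine integral_mono ((((hint.sub (integrable_const m)).const_mul t).add
    (integrable_const _)).const_mul _) (h t) fun x => ?_
  calc Real.exp (t * m) * (t * (x - m) + 1) ≤ Real.exp (t * m) * Real.exp (t * (x - m)) := by
        gcongr; exact Real.add_one_le_exp _
    _ = Real.exp (t * id x) := by rw [← Real.exp_add]; simp; ring_nf

/-- **Cramér's theorem**: the components of a normal distribution are normal (possibly
degenerate). -/
theorem cramer {m : ℝ} {v : ℝ≥0} (h : μ ∗ ν = gaussianReal m v) :
    ∃ (m' : ℝ) (v' : ℝ≥0), μ = gaussianReal m' v' := by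
  have hμ : ∀ t : ℝ, Integrable (fun x => Real.exp (t * x)) μ := fun t =>
    integrable_exp_of_conv (ν := ν) (by rw [h]; exact integrable_exp_mul_gaussianReal t)
  have hν : ∀ t : ℝ, Integrable (fun x => Real.exp (t * x)) ν := fun t =>
    integrable_exp_of_conv (ν := μ) (by
      rw [Measure.conv_comm, h]; exact integrable_exp_mul_gaussianReal t)
  have huniv : integrableExpSet id μ = Set.univ := Set.eq_univ_of_forall hμ
  have hmul : ∀ z, complexMGF id μ z * complexMGF id ν z = Complex.exp (z * m + v * z ^ 2 / 2) :=
    fun z => by rw [← complexMGF_conv, h, complexMGF_id_gaussianReal]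
  have hder : ∀ z, HasDerivAt (complexMGF id μ) (∫ x, (x : ℂ) * Complex.exp (z * x) ∂μ) z :=
    fun z => hasDerivAt_complexMGF (by rw [huniv]; simp)
  set a := ∫ x, x ∂ν with ha
  have hbound : ∀ z, ‖complexMGF id μ z‖
      ≤ Real.exp ((|m| + |a| + v + 1) * (1 + ‖z‖) ^ 2) := by
    intro z
    refine norm_complexMGF_le_mgf.trans ?_
    set t := z.re with ht
    have h1 : mgf id μ t * mgf id ν t = Real.exp (t * m + v * t ^ 2 / 2) := by
      have := hmul t
      rw [complexMGF_ofReal, complexMGF_ofReal] at this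
      exact_mod_cast this
    have h2 := exp_mean_le_mgf hν t
    have h3 : mgf id μ t * Real.exp (t * a) ≤ Real.exp (t * m + v * t ^ 2 / 2) := by
      rw [← h1]; gcongr; exact mgf_nonneg
    have h4 : mgf id μ t ≤ Real.exp (t * m + v * t ^ 2 / 2 - t * a) := by
      rw [Real.exp_sub, le_div_iff₀ (Real.exp_pos _)]; exact h3
    refine h4.trans (Real.exp_le_exp.2 ?_)
    have h5 : |t| ≤ ‖z‖ := Complex.abs_re_le_norm z
    have h6 : t * m ≤ ‖z‖ * |m| := (le_abs_self _).trans (by rw [abs_mul]; gcongr)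
    have h7 : -(t * a) ≤ ‖z‖ * |a| := (neg_le_abs _).trans (by rw [abs_mul]; gcongr)
    have h8 : t ^ 2 ≤ ‖z‖ ^ 2 := by rw [← sq_abs]; gcongr
    have h9 : v * t ^ 2 ≤ v * ‖z‖ ^ 2 := by gcongr
    have h10 : (0 : ℝ) ≤ v := v.2
    have h11 := norm_nonneg z
    have h12 := abs_nonneg m
    have h13 := abs_nonneg a
    nlinarith [mul_nonneg h12 h11, mul_nonneg h13 h11, mul_nonneg h12 (sq_nonneg ‖z‖),
      mul_nonneg h13 (sq_nonneg ‖z‖), mul_nonneg h10 h11, mul_nonneg h10 (sq_nonneg ‖z‖)]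
  obtain ⟨b, c, hbc⟩ := exists_exp_quadratic (fun z => (hder z).differentiableAt)
    (fun z hz => Complex.exp_ne_zero _ ((hmul z).symm.trans (by rw [hz, zero_mul])))
    (by simp [complexMGF]) (K := |m| + |a| + v + 1) (by positivity) hbound
  -- On the real line the logarithmic derivative `b + c * t` is real, so `b` and `c` are real.
  have hlog : ∀ t : ℝ, ((mgf id μ t)⁻¹ * ∫ x, x * Real.exp (t * x) ∂μ : ℝ) = b + c * t := by
    intro t
    have h1 := hder t
    have h2 : HasDerivAt (fun z => Complex.exp (b * z + c * z ^ 2 / 2))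
        (Complex.exp (b * t + c * t ^ 2 / 2) * (b + c * t)) (t : ℂ) := by
      refine (((hasDerivAt_id (t : ℂ)).const_mul b).add
        (((hasDerivAt_pow 2 (t : ℂ)).const_mul c).div_const 2)).cexp.congr_deriv ?_
      simp
      ring
    rw [funext hbc] at h1
    have h3 := h1.unique h2
    rw [← hbc, complexMGF_ofReal] at h3
    have h4 : ∫ x, (x : ℂ) * Complex.exp (t * x) ∂μ
        = ((∫ x, x * Real.exp (t * x) ∂μ : ℝ) : ℂ) := by
      rw [← integral_complex_ofReal]
      congr 1
      ext x
      push_cast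
      ring
    rw [h4] at h3
    have h5 : (mgf id μ t : ℂ) ≠ 0 := by exact_mod_cast (mgf_pos (hμ t)).ne'
    push_cast
    rw [h3]
    field_simp
  set b' : ℝ := ∫ x, x ∂μ with hb'
  have e0 : (b' : ℂ) = b := by
    have := hlog 0
    simpa [mgf] using this
  obtain ⟨c', e1⟩ : ∃ c' : ℝ, (c' : ℂ) = c := by
    refine ⟨(mgf id μ 1)⁻¹ * ∫ x, x * Real.exp (1 * x) ∂μ - b', ?_⟩
    have := hlog 1
    rw [Complex.ofReal_sub, this, e0]
    simp
  have hc' : 0 ≤ c' := by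
    have h1 := exp_mean_le_mgf hμ 1
    have h2 : mgf id μ 1 = Real.exp (b' * 1 + c' * 1 ^ 2 / 2) := by
      have := hbc (1 : ℝ)
      rw [complexMGF_ofReal, ← e0, ← e1] at this
      exact_mod_cast this
    rw [h2, Real.exp_le_exp] at h1
    linarith
  lift c' to ℝ≥0 using hc'
  refine ⟨b', c', Measure.ext_of_complexMGF_id_eq (funext fun z => ?_)⟩
  rw [complexMGF_id_gaussianReal, hbc, ← e0, ← e1]
  congr 1
  ring

end Cramer

/-! ### A functional equation for scores, and normal laws -/

/-- The exponential of a quadratic polynomial. -/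
noncomputable def expQuad (a b c x : ℝ) : ℝ := Real.exp (a + b * x + c * x ^ 2)

lemma continuous_expQuad (a b c : ℝ) : Continuous (expQuad a b c) := by
  unfold expQuad; fun_prop

lemma expQuad_eq_of_eventuallyEq {a b c a' b' c' s : ℝ}
    (h : ∀ᶠ x in 𝓝 s, expQuad a b c x = expQuad a' b' c' x) : expQuad a b c = expQuad a' b' c' := by
  obtain ⟨ε, hε, h⟩ := Metric.eventually_nhds_iff.1 h
  have key : ∀ x, |x - s| < ε → a + b * x + c * x ^ 2 = a' + b' * x + c' * x ^ 2 := fun x hx =>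
    Real.exp_injective (h (by rwa [Real.dist_eq]))
  have h0 := key s (by simpa using hε)
  have h1 := key (s + ε / 2) (by rw [add_sub_cancel_left, abs_of_pos (by linarith)]; linarith)
  have h2 := key (s - ε / 2) (by
    rw [sub_sub_cancel_left, abs_neg, abs_of_pos (by linarith)]; linarith)
  have hc : c = c' := by
    have : (c - c') * ε ^ 2 = 0 := by linear_combination 2 * h1 + 2 * h2 - 4 * h0
    rcases mul_eq_zero.1 this with h | h
    · linarith
    · exact absurd h (by positivity)
  subst hc
  have hb : b = b' := by
    have : (b - b') * ε = 0 := by linear_combination h1 - h2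
    rcases mul_eq_zero.1 this with h | h
    · linarith
    · exact absurd h hε.ne'
  subst hb
  have ha : a = a' := by linarith
  rw [ha]

namespace IsACDensity

variable {μ : Measure ℝ} {f : ℝ → ℝ}

/-- A density which is locally the exponential of a quadratic polynomial where it does not vanish
is so globally: it cannot reach `0` at the end of an interval. -/
lemma eq_expQuad [IsProbabilityMeasure μ] (hf : IsACDensity μ f)
    (h : ∀ x, 0 < f x → ∃ a b c, ∀ᶠ y in 𝓝 x, f y = expQuad a b c y) :
    ∃ a b c, f = expQuad a b c := by
  obtain ⟨x₀, hx₀⟩ : ∃ x, 0 < f x := by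
    by_contra hcon
    have : ∀ x, f x = 0 := fun x => le_antisymm (not_lt.1 fun hx => hcon ⟨x, hx⟩) (hf.1 x)
    have h1 := hf.integral_eq_one
    simp [this] at h1
  obtain ⟨a, b, c, hq⟩ := h x₀ hx₀
  refine ⟨a, b, c, ?_⟩
  set S := {x | ∀ᶠ y in 𝓝 x, f y = expQuad a b c y} with hS
  have hSo : IsOpen S := isOpen_setOfPred_eventually_nhds
  have hSsub : S ⊆ {x | f x = expQuad a b c x} := fun x hx => Eventually.self_of_nhds hx
  have hSc : IsClosed S := by
    rw [← closure_subset_iff_isClosed]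
    intro x hx
    have hx1 : f x = expQuad a b c x :=
      closure_minimal hSsub (isClosed_eq hf.continuous (continuous_expQuad a b c)) hx
    obtain ⟨a', b', c', hq'⟩ := h x (by rw [hx1]; exact Real.exp_pos _)
    obtain ⟨y, hy, hyS⟩ := mem_closure_iff_nhds.1 hx _ (eventually_eventually_nhds.2 hq')
    have heq : expQuad a b c = expQuad a' b' c' := by
      refine expQuad_eq_of_eventuallyEq (s := y) ?_
      filter_upwards [hyS, hy] with z hz1 hz2
      rw [← hz1, ← hz2]
    simp only [hS, Set.mem_ofPred_eq, heq]
    exact hq'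
  have := (IsClopen.eq_univ ⟨hSc, hSo⟩ ⟨x₀, hq⟩)
  exact funext fun x => hSsub (this ▸ Set.mem_univ x)

lemma not_integrable_of_le {g : ℝ → ℝ} {k : ℝ} (hk : 0 < k) {s : Set ℝ} (hs : MeasurableSet s)
    (hv : volume s = ∞) (h : ∀ x ∈ s, k ≤ g x) : ¬ Integrable g := by
  intro hg
  have h1 : IntegrableOn (fun _ => k) s := by
    refine (hg.integrableOn (s := s)).mono' (by fun_prop) ?_
    filter_upwards [ae_restrict_mem hs] with x hx
    rw [Real.norm_of_nonneg hk.le]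
    exact h x hx
  rcases (integrableOn_const_iff).1 h1 with h2 | h2
  · exact hk.ne' (enorm_eq_zero.1 h2)
  · exact absurd hv h2.ne

lemma eq_gaussianReal [IsProbabilityMeasure μ] {a b c : ℝ} (hf : IsACDensity μ (expQuad a b c)) :
    ∃ (m : ℝ) (v : ℝ≥0), 0 < v ∧ μ = gaussianReal m v := by
  -- Otherwise the density is bounded below by `exp a` on one of the two half-lines.
  have hc : c < 0 := by
    by_contra hc
    push Not at hc
    rcases le_total 0 b with hb | hb
    · refine not_integrable_of_le (Real.exp_pos a) (measurableSet_Ici (a := (0 : ℝ)))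
        Real.volume_Ici (fun x hx => Real.exp_le_exp.2 ?_) hf.integrable
      have : (0 : ℝ) ≤ x := hx
      nlinarith [mul_nonneg hb this, mul_nonneg hc (sq_nonneg x)]
    · refine not_integrable_of_le (Real.exp_pos a) (measurableSet_Iic (a := (0 : ℝ)))
        Real.volume_Iic (fun x hx => Real.exp_le_exp.2 ?_) hf.integrable
      have : x ≤ (0 : ℝ) := hx
      nlinarith [mul_nonneg_of_nonpos_of_nonpos hb this, mul_nonneg hc (sq_nonneg x)]
  obtain ⟨v, hv⟩ : ∃ v : ℝ≥0, (v : ℝ) = -1 / (2 * c) :=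
    ⟨⟨-1 / (2 * c), (div_pos_of_neg_of_neg (by norm_num) (by linarith)).le⟩, rfl⟩
  have hv0 : (0 : ℝ) < v := by
    rw [hv]; exact div_pos_of_neg_of_neg (by norm_num) (by linarith)
  have hv0' : v ≠ 0 := fun h => by simp [h] at hv0
  set m := -b / (2 * c) with hm
  set A := √(2 * Real.pi * v) with hA
  have hA0 : A ≠ 0 := by positivity
  obtain ⟨k, hk⟩ : ∃ k, ∀ x, expQuad a b c x = k * gaussianPDFReal m v x := by
    refine ⟨Real.exp (a - c * m ^ 2) * A, fun x => ?_⟩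
    rw [gaussianPDFReal, ← hA, mul_assoc, mul_inv_cancel_left₀ hA0, ← Real.exp_add, expQuad]
    congr 1
    have hc0 : c ≠ 0 := hc.ne
    have e1 : -(x - m) ^ 2 / (2 * v) = c * (x - m) ^ 2 := by rw [hv]; field_simp
    have e2 : b = -(2 * c * m) := by rw [hm]; field_simp
    rw [e1, e2]
    ring
  have hk1 : k = 1 := by
    have := hf.integral_eq_one
    simp only [hk, integral_const_mul, integral_gaussianPDFReal_eq_one m hv0'] at this
    linarith
  refine ⟨m, v, by exact_mod_cast hv0, ?_⟩
  rw [gaussianReal_of_var_ne_zero m hv0', hf.2.2]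
  simp only [hk, hk1, one_mul]
  rfl

section Log

/-- The logarithm of an absolutely continuous function is absolutely continuous on an interval
where the function is positive. -/
lemma absolutelyContinuous_log {g : ℝ → ℝ} {u v : ℝ} (hg : AbsolutelyContinuousOnInterval g u v)
    (hpos : ∀ x ∈ Set.uIcc u v, 0 < g x) :
    AbsolutelyContinuousOnInterval (fun x => Real.log (g x)) u v := by
  obtain ⟨x₀, hx₀, hmin⟩ := isCompact_uIcc.exists_isMinOn Set.nonempty_uIcc hg.continuousOn
  set k := g x₀ with hk
  have hk0 : 0 < k := hpos x₀ hx₀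
  have hlip : ∀ x ∈ Set.uIcc u v, ∀ y ∈ Set.uIcc u v,
      dist (Real.log (g x)) (Real.log (g y)) ≤ k⁻¹ * dist (g x) (g y) := by
    have aux : ∀ x ∈ Set.uIcc u v, ∀ y ∈ Set.uIcc u v,
        Real.log (g x) - Real.log (g y) ≤ k⁻¹ * |g x - g y| := by
      intro x hx y hy
      have hgx := hpos x hx
      have hgy := hpos y hy
      have h1 : k ≤ g y := hmin hy
      rw [← Real.log_div hgx.ne' hgy.ne']
      calc Real.log (g x / g y) ≤ g x / g y - 1 := Real.log_le_sub_one_of_pos (by positivity)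
        _ = (g x - g y) / g y := by field_simp
        _ ≤ |g x - g y| / g y := by gcongr; exact le_abs_self _
        _ ≤ |g x - g y| / k := by gcongr
        _ = _ := by ring
    intro x hx y hy
    rw [Real.dist_eq, Real.dist_eq, abs_sub_le_iff]
    exact ⟨aux x hx y hy, by rw [abs_sub_comm]; exact aux y hy x hx⟩
  rw [absolutelyContinuousOnInterval_iff] at hg ⊢
  intro ε hε
  obtain ⟨δ, hδ, H⟩ := hg (k * ε) (by positivity)
  refine ⟨δ, hδ, fun E hE hEδ => ?_⟩
  have h1 := H E hE hEδ
  calc ∑ i ∈ Finset.range E.1, dist (Real.log (g (E.2 i).1)) (Real.log (g (E.2 i).2))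
      ≤ ∑ i ∈ Finset.range E.1, k⁻¹ * dist (g (E.2 i).1) (g (E.2 i).2) :=
        Finset.sum_le_sum fun i hi => hlip _ (hE.1 i hi).1 _ (hE.1 i hi).2
    _ = k⁻¹ * ∑ i ∈ Finset.range E.1, dist (g (E.2 i).1) (g (E.2 i).2) := by
        rw [Finset.mul_sum]
    _ < k⁻¹ * (k * ε) := by gcongr
    _ = ε := by field_simp

variable {u v : ℝ}

lemma ae_deriv_log (hf : IsACDensity μ f) (hpos : ∀ x ∈ Set.uIcc u v, 0 < f x) :
    ∀ᵐ x, x ∈ Set.uIoc u v → deriv (fun x => Real.log (f x)) x = score f x := by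
  filter_upwards [hf.ae_differentiableAt] with x hx hxu
  exact (hx.hasDerivAt.log (hpos x (Set.uIoc_subset_uIcc hxu)).ne').deriv

lemma intervalIntegrable_score (hf : IsACDensity μ f) (hpos : ∀ x ∈ Set.uIcc u v, 0 < f x) :
    IntervalIntegrable (score f) volume u v :=
  (absolutelyContinuous_log (hf.2.1 u v) hpos).intervalIntegrable_deriv.congr_ae
    ((ae_restrict_iff' measurableSet_uIoc).2 (hf.ae_deriv_log hpos))

lemma integral_score_eq (hf : IsACDensity μ f) (hpos : ∀ x ∈ Set.uIcc u v, 0 < f x) :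
    ∫ x in u..v, score f x = Real.log (f v) - Real.log (f u) := by
  rw [← (absolutelyContinuous_log (hf.2.1 u v) hpos).integral_deriv_eq_sub]
  refine intervalIntegral.integral_congr_ae ?_
  filter_upwards [hf.ae_deriv_log hpos] with x hx hxu
  exact (hx hxu).symm

end Log

/-- A density with a score that is almost everywhere an affine function near `x₀` is near `x₀` the
exponential of a quadratic polynomial. -/
lemma eventually_eq_expQuad (hf : IsACDensity μ f) {x₀ ε b c : ℝ} (hε : 0 < ε)
    (hpos : ∀ x, |x - x₀| < ε → 0 < f x)
    (h : ∀ᵐ x, |x - x₀| < ε → score f x = b + c * x) :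
    ∃ a b c, ∀ᶠ y in 𝓝 x₀, f y = expQuad a b c y := by
  refine ⟨Real.log (f x₀) - b * x₀ - c / 2 * x₀ ^ 2, b, c / 2, ?_⟩
  filter_upwards [Metric.ball_mem_nhds x₀ hε] with y hy
  rw [Metric.mem_ball, Real.dist_eq] at hy
  have hsub : ∀ x ∈ Set.uIcc x₀ y, |x - x₀| < ε := fun x hx =>
    (Set.abs_sub_left_of_mem_uIcc hx).trans_lt hy
  have h1 := hf.integral_score_eq (u := x₀) (v := y) fun x hx => hpos x (hsub x hx)
  have h2 : ∫ x in x₀..y, score f x = ∫ x in x₀..y, (b + c * x) := by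
    refine intervalIntegral.integral_congr_ae ?_
    filter_upwards [h] with x hx hxu
    exact hx (hsub x (Set.uIoc_subset_uIcc hxu))
  rw [intervalIntegral.integral_add (by simp) (by
    exact (continuous_const.mul continuous_id).intervalIntegrable _ _),
    intervalIntegral.integral_const, intervalIntegral.integral_const_mul, integral_id] at h2
  have h3 : Real.log (f y) = Real.log (f x₀) - b * x₀ - c / 2 * x₀ ^ 2 + b * y + c / 2 * y ^ 2 := by
    rw [h2] at h1
    simp only [smul_eq_mul] at h1
    linear_combination -h1
  rw [expQuad, ← h3, Real.exp_log (hpos y hy)]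

/-- If the score is shifted by a constant under translations by arbitrarily small steps `δ n`,
then it is affine near every point where the density is positive: the difference quotients of
the logarithm of the density with steps `δ n` are affine functions, and so is their limit. -/
lemma eventually_eq_expQuad_of_shift (hf : IsACDensity μ f) {δ c : ℕ → ℝ}
    (hδ : Tendsto δ atTop (𝓝 0)) (hδ0 : ∀ n, δ n ≠ 0)
    (h : ∀ n, ∀ᵐ x, 0 < f x → 0 < f (x + δ n) → score f (x + δ n) - score f x = c n)
    {x₀ : ℝ} (hx₀ : 0 < f x₀) : ∃ a b c, ∀ᶠ y in 𝓝 x₀, f y = expQuad a b c y := by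
  obtain ⟨ε', hε', hpos'⟩ := Metric.eventually_nhds_iff.1
    (hf.continuous.continuousAt.eventually (lt_mem_nhds hx₀))
  obtain ⟨ε, hε, hpos⟩ : ∃ ε > 0, ∀ x, |x - x₀| < 2 * ε → 0 < f x :=
    ⟨ε' / 2, by linarith, fun x hx => hpos' (by rw [Real.dist_eq]; linarith)⟩
  have hpos1 : ∀ x, |x - x₀| < ε → 0 < f x := fun x hx => hpos x (by linarith)
  set L := fun x => Real.log (f x) with hL
  have hsmall : ∀ᶠ n in atTop, |δ n| < ε := by
    filter_upwards [hδ (Metric.ball_mem_nhds 0 hε)] with n hn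
    simpa using hn
  -- `L (z + δ n) - L z` is an affine function of `z` near `x₀`.
  have haff : ∀ n, |δ n| < ε → ∀ z, |z - x₀| < ε →
      L (z + δ n) - L z = L (x₀ + δ n) - L x₀ + c n * (z - x₀) := by
    intro n hn z hz
    have hsub : ∀ x ∈ Set.uIcc x₀ z, |x - x₀| < ε := fun x hx =>
      (Set.abs_sub_left_of_mem_uIcc hx).trans_lt hz
    have hsub2 : ∀ x, |x - x₀| < ε → 0 < f (x + δ n) := fun x hx => hpos _ (by
      calc |x + δ n - x₀| = |(x - x₀) + δ n| := by ring_nf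
        _ ≤ |x - x₀| + |δ n| := abs_add_le _ _
        _ < 2 * ε := by linarith)
    have hp1 : ∀ x ∈ Set.uIcc x₀ z, 0 < f x := fun x hx => hpos1 x (hsub x hx)
    have hp2 : ∀ x ∈ Set.uIcc (x₀ + δ n) (z + δ n), 0 < f x := by
      intro x hx
      have : x - δ n ∈ Set.uIcc x₀ z := by
        rw [Set.mem_uIcc] at hx ⊢
        rcases hx with hx | hx
        · left; constructor <;> linarith [hx.1, hx.2]
        · right; constructor <;> linarith [hx.1, hx.2]
      simpa using hsub2 _ (hsub _ this)
    have i1 := hf.integral_score_eq hp1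
    have i2 := hf.integral_score_eq hp2
    rw [← intervalIntegral.integral_comp_add_right (score f)] at i2
    have i3 : ∫ x in x₀..z, (score f (x + δ n) - score f x) = ∫ x in x₀..z, c n := by
      refine intervalIntegral.integral_congr_ae ?_
      filter_upwards [h n] with x hx hxu
      have hx' := hsub x (Set.uIoc_subset_uIcc hxu)
      exact hx (hpos1 x hx') (hsub2 x hx')
    rw [intervalIntegral.integral_sub
      (by simpa using (hf.intervalIntegrable_score hp2).comp_add_right (δ n))
      (hf.intervalIntegrable_score hp1), i1, i2, intervalIntegral.integral_const,
      smul_eq_mul] at i3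
    simp only [hL]
    linear_combination i3
  have hquot : ∀ z, |z - x₀| < ε → DifferentiableAt ℝ f z →
      Tendsto (fun n => (L (x₀ + δ n) - L x₀) / δ n + c n / δ n * (z - x₀)) atTop
        (𝓝 (score f z)) := by
    intro z hz hd
    have hd' : HasDerivAt L (score f z) z := hd.hasDerivAt.log (hpos1 z hz).ne'
    have hδ' : Tendsto δ atTop (𝓝[≠] 0) :=
      tendsto_nhdsWithin_iff.2 ⟨hδ, Eventually.of_forall hδ0⟩
    have := hd'.tendsto_slope_zero.comp hδ'
    refine this.congr' ?_
    filter_upwards [hsmall] with n hn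
    have h1 := haff n hn z hz
    have h2 := hδ0 n
    simp only [Function.comp, smul_eq_mul, h1]
    field_simp
  have hdense := Measure.dense_of_ae hf.ae_differentiableAt
  obtain ⟨z₁, hz₁, hz₁'⟩ := hdense.exists_between (show x₀ - ε < x₀ by linarith)
  obtain ⟨z₂, hz₂, hz₂'⟩ := hdense.exists_between (show x₀ < x₀ + ε by linarith)
  have t1 := hquot z₁ (by rw [abs_lt]; constructor <;> linarith [hz₁'.1, hz₁'.2]) hz₁
  have t2 := hquot z₂ (by rw [abs_lt]; constructor <;> linarith [hz₂'.1, hz₂'.2]) hz₂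
  have hz12 : z₂ - z₁ ≠ 0 := by linarith [hz₁'.2, hz₂'.1]
  obtain ⟨Q, hQ⟩ : ∃ Q, Tendsto (fun n => c n / δ n) atTop (𝓝 Q) := by
    refine ⟨(score f z₂ - score f z₁) / (z₂ - z₁), ((t2.sub t1).div_const (z₂ - z₁)).congr ?_⟩
    intro n
    field_simp
    ring
  obtain ⟨P, hP⟩ : ∃ P, Tendsto (fun n => (L (x₀ + δ n) - L x₀) / δ n) atTop (𝓝 P) := by
    refine ⟨score f z₁ - Q * (z₁ - x₀), (t1.sub (hQ.mul_const (z₁ - x₀))).congr ?_⟩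
    intro n
    ring
  refine hf.eventually_eq_expQuad (b := P - Q * x₀) (c := Q) hε hpos1 ?_
  filter_upwards [hf.ae_differentiableAt] with z hz hzε
  rw [tendsto_nhds_unique (hquot z hzε hz) (hP.add (hQ.mul_const (z - x₀)))]
  ring

/-- If the score `score F (z + w)` is an affine function of `score f z` for `w` in a
set of values that accumulates at one of its points `w₀`, then the density `F` is normal. -/
lemma eq_gaussianReal_of_score [IsProbabilityMeasure μ] (hf : IsACDensity μ f) {τ : Measure ℝ}
    [IsProbabilityMeasure τ] {F : ℝ → ℝ} (hF : IsACDensity τ F) {α : ℝ} (hα : α ≠ 0)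
    {w k : ℕ → ℝ} {w₀ k₀ : ℝ} (hw : Tendsto w atTop (𝓝 w₀)) (hne : ∀ n, w n ≠ w₀)
    (h : ∀ n, ∀ᵐ z ∂μ, score F (z + w n) = α * score f z + k n)
    (h₀ : ∀ᵐ z ∂μ, score F (z + w₀) = α * score f z + k₀) :
    ∃ (m : ℝ) (v : ℝ≥0), 0 < v ∧ τ = gaussianReal m v := by
  rw [hf.ae_iff] at h₀
  have hshift : ∀ a : ℝ, ∀ {p : ℝ → Prop}, (∀ᵐ x, p x) → ∀ᵐ x, p (x + a) := fun a p hp =>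
    (measurePreserving_add_right volume a).quasiMeasurePreserving.ae hp
  obtain ⟨a, b, c, hq⟩ := hf.eq_expQuad fun x hx =>
    hf.eventually_eq_expQuad_of_shift (δ := fun n => w n - w₀) (c := fun n => (k n - k₀) / α)
      (by simpa using hw.sub_const w₀) (fun n => sub_ne_zero.2 (hne n)) (fun n => by
        filter_upwards [(hf.ae_iff _).1 (h n), hshift (w n - w₀) h₀] with x h1 h2 hx1 hx2
        have h3 := h1 hx1
        have h4 := h2 hx2
        rw [show x + (w n - w₀) + w₀ = x + w n by ring, h3] at h4
        field_simp
        linear_combination -h4) hx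
  have hscore : ∀ z, score f z = b + 2 * c * z := by
    intro z
    have hd : HasDerivAt f (expQuad a b c z * (b + 2 * c * z)) z := by
      rw [hq]
      refine ((((hasDerivAt_id z).const_mul b).const_add a).add
        ((hasDerivAt_pow 2 z).const_mul c)).exp.congr_deriv ?_
      simp [expQuad]
      ring
    rw [score, hd.deriv, hq]
    exact mul_div_cancel_left₀ _ (Real.exp_pos _).ne'
  have hF' : ∀ᵐ x, score F x = (α * (b - 2 * c * w₀) + k₀) + 2 * c * α * x := by
    filter_upwards [hshift (-w₀) h₀] with x hx
    have := hx (by rw [hq]; exact Real.exp_pos _)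
    rw [neg_add_cancel_right, hscore] at this
    rw [this]
    ring
  obtain ⟨a', b', c', hq'⟩ := hF.eq_expQuad fun x hx => by
    obtain ⟨ε, hε, hpos⟩ := Metric.eventually_nhds_iff.1
      (hF.continuous.continuousAt.eventually (lt_mem_nhds hx))
    exact hF.eventually_eq_expQuad hε (fun y hy => hpos (by rwa [Real.dist_eq]))
      (by filter_upwards [hF'] with y hy _ using hy)
  exact eq_gaussianReal (hq' ▸ hF)

end IsACDensity

/-- An uncountable set of real numbers accumulates at one of its points. -/
lemma exists_seq_tendsto_of_not_countable {s : Set ℝ} (hs : ¬ s.Countable) :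
    ∃ w₀ ∈ s, ∃ w : ℕ → ℝ, Tendsto w atTop (𝓝 w₀) ∧ ∀ n, w n ∈ s ∧ w n ≠ w₀ := by
  obtain ⟨w₀, hw₀, h⟩ : ∃ x ∈ s, ∀ y, x < y → (s ∩ Set.Ioo x y).Nonempty := by
    by_contra! hcon
    refine hs (Set.Countable.mono (fun x hx => ?_)
      (countable_setOfPred_isolated_right_within (s := s)))
    obtain ⟨y, hxy, hy⟩ := hcon x hx
    refine ⟨hx, empty_mem_iff_bot.1 (mem_nhdsWithin.2 ⟨Set.Iio y, isOpen_Iio, hxy, ?_⟩)⟩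
    rw [← hy]
    exact fun z hz => ⟨hz.2.1, hz.2.2, hz.1⟩
  have hpos : ∀ n : ℕ, w₀ < w₀ + 1 / ((n : ℝ) + 1) := fun n => by
    have : 0 < 1 / ((n : ℝ) + 1) := by positivity
    linarith
  choose w hw using fun n : ℕ => h _ (hpos n)
  refine ⟨w₀, hw₀, w, ?_, fun n => ⟨(hw n).1, (hw n).2.1.ne'⟩⟩
  have h1 : Tendsto (fun n : ℕ => w₀ + 1 / ((n : ℝ) + 1)) atTop (𝓝 w₀) := by
    simpa using tendsto_one_div_add_atTop_nhds_zero_nat.const_add w₀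
  exact tendsto_of_tendsto_of_tendsto_of_le_of_le tendsto_const_nhds h1
    (fun n => (hw n).2.1.le) (fun n => (hw n).2.2.le)

/-- The functional equation which equality in the Fisher information inequality leads to: if it
holds for uncountably many shifts `w`, then it forces the law of the sum to be normal. -/
lemma IsACDensity.eq_gaussianReal_of_not_countable {μ τ : Measure ℝ} [IsProbabilityMeasure μ]
    [IsProbabilityMeasure τ] {f F : ℝ → ℝ} (hf : IsACDensity μ f) (hF : IsACDensity τ F)
    {α : ℝ} (hα : α ≠ 0)
    (h : ¬ {w : ℝ | ∃ k, ∀ᵐ z ∂μ, score F (z + w) = α * score f z + k}.Countable) :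
    ∃ (m : ℝ) (v : ℝ≥0), 0 < v ∧ τ = gaussianReal m v := by
  obtain ⟨w₀, ⟨k₀, h₀⟩, w, hw, hws⟩ := exists_seq_tendsto_of_not_countable h
  choose k hk using fun n => (hws n).1
  exact hf.eq_gaussianReal_of_score hF hα hw (fun n => (hws n).2) hk h₀

section Gaussian

lemma isACDensity_gaussianReal (m : ℝ) {v : ℝ≥0} (hv : v ≠ 0) :
    IsACDensity (gaussianReal m v) (gaussianPDFReal m v) := by
  refine ⟨gaussianPDFReal_nonneg m v, fun a b => ?_, gaussianReal_of_var_ne_zero m hv⟩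
  refine ContDiffOn.absolutelyContinuousOnInterval (ContDiff.contDiffOn ?_)
  unfold gaussianPDFReal
  fun_prop

lemma score_gaussianPDFReal (m : ℝ) {v : ℝ≥0} (hv : v ≠ 0) (x : ℝ) :
    score (gaussianPDFReal m v) x = -(x - m) / v := by
  have hd : HasDerivAt (gaussianPDFReal m v) (gaussianPDFReal m v x * (-(x - m) / v)) x := by
    have h1 : HasDerivAt (fun x : ℝ => -(x - m) ^ 2 / (2 * v)) (-(x - m) / v) x := by
      refine ((((hasDerivAt_id x).sub_const m).pow 2).neg.div_const (2 * (v : ℝ))).congr_deriv ?_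
      have : (v : ℝ) ≠ 0 := by exact_mod_cast hv
      simp
      field_simp
      ring
    refine (h1.exp.const_mul _).congr_deriv ?_
    rw [gaussianPDFReal]
    ring
  rw [score, hd.deriv]
  exact mul_div_cancel_left₀ _ (gaussianPDFReal_pos m v x hv).ne'

lemma fisherInfo_gaussianReal (m : ℝ) {v : ℝ≥0} (hv : v ≠ 0) :
    fisherInfo (gaussianReal m v) = (v : ℝ≥0∞)⁻¹ := by
  have hv' : (v : ℝ) ≠ 0 := by exact_mod_cast hv
  have hd := isACDensity_gaussianReal m hv
  have h2 : MemLp (fun x : ℝ => x - m) 2 (gaussianReal m v) :=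
    (memLp_id_gaussianReal 2).sub (memLp_const m)
  have e1 : ∀ x, score (gaussianPDFReal m v) x ^ 2 = ((v : ℝ) ^ 2)⁻¹ * (x - m) ^ 2 := fun x => by
    rw [score_gaussianPDFReal m hv]
    field_simp
  have h3 : MemLp (score (gaussianPDFReal m v)) 2 (gaussianReal m v) := by
    rw [memLp_two_iff_integrable_sq hd.measurable_score.aestronglyMeasurable]
    simp only [e1]
    exact h2.integrable_sq.const_mul _
  have h4 : ∫ x, (x - m) ^ 2 ∂(gaussianReal m v) = v := by
    have := variance_fun_id_gaussianReal (μ := m) (v := v)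
    rw [variance_eq_integral (by fun_prop), integral_id_gaussianReal] at this
    exact this
  rw [hd.fisherInfo_eq_ofReal h3]
  simp only [e1, integral_const_mul, h4]
  rw [show ((v : ℝ) ^ 2)⁻¹ * v = ((v⁻¹ : ℝ≥0) : ℝ) by push_cast; field_simp,
    ENNReal.ofReal_coe_nnreal, ENNReal.coe_inv hv]

lemma not_hasACDensity_dirac (m : ℝ) : ¬ HasACDensity (Measure.dirac m) := by
  rintro ⟨f, hf⟩
  have := hf.absolutelyContinuous (Real.volume_singleton (a := m))
  simp at this

/-- The reciprocal of the Fisher information of a normal law is its variance, also in the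
degenerate case, where the Fisher information is infinite. -/
lemma one_div_fisherInfo_gaussianReal (m : ℝ) (v : ℝ≥0) :
    1 / fisherInfo (gaussianReal m v) = v := by
  rcases eq_or_ne v 0 with rfl | hv
  · rw [gaussianReal_zero_var, fisherInfo_eq_top (not_hasACDensity_dirac m)]
    simp
  · rw [fisherInfo_gaussianReal m hv, one_div, inv_inv]

end Gaussian

/-! ### Sums over subsets of the coordinates -/

section SubsetSums

variable {ι : Type*} [Fintype ι] [DecidableEq ι]

/-- The sum of the coordinates in `s`. -/
def coordSum (s : Finset ι) (x : ι → ℝ) : ℝ := ∑ i ∈ s, x i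

/-- The law of the sum over `s` of independent variables with laws `μ i`. -/
noncomputable def sumLaw (μ : ι → Measure ℝ) (s : Finset ι) : Measure ℝ :=
  (Measure.pi μ).map (coordSum s)

omit [Fintype ι] [DecidableEq ι] in
lemma measurable_coordSum (s : Finset ι) : Measurable (coordSum s) := by
  unfold coordSum; fun_prop

omit [Fintype ι] [DecidableEq ι] in
lemma dependsOn_coordSum (s : Finset ι) : DependsOn (coordSum s) (s : Set ι) :=
  fun _ _ h => Finset.sum_congr rfl fun i hi => h i hi

omit [Fintype ι] in
lemma coordSum_union {s t : Finset ι} (h : Disjoint s t) (x : ι → ℝ) :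
    coordSum (s ∪ t) x = coordSum s x + coordSum t x :=
  Finset.sum_union h

variable {μ : ι → Measure ℝ} [∀ i, IsProbabilityMeasure (μ i)]

instance (s : Finset ι) : IsProbabilityMeasure (sumLaw μ s) :=
  Measure.isProbabilityMeasure_map (measurable_coordSum s).aemeasurable

omit [DecidableEq ι] [∀ i, IsProbabilityMeasure (μ i)] in
lemma measurePreserving_coordSum (s : Finset ι) :
    MeasurePreserving (coordSum s) (Measure.pi μ) (sumLaw μ s) :=
  ⟨measurable_coordSum s, rfl⟩

omit [DecidableEq ι] in
lemma measurePreserving_coordSum_prod {s t : Finset ι} (h : Disjoint s t) :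
    MeasurePreserving (fun x => (coordSum s x, coordSum t x)) (Measure.pi μ)
      ((sumLaw μ s).prod (sumLaw μ t)) := by
  have h1 : iIndepFun (fun (i : ι) (x : ι → ℝ) => x i) (Measure.pi μ) :=
    iIndepFun_pi (X := fun _ y => y) fun _ => aemeasurable_id
  have h2 := (h1.indepFun_finset s t h fun i => measurable_pi_apply i).comp
    (φ := fun y : s → ℝ => ∑ i, y i) (ψ := fun y : t → ℝ => ∑ i, y i) (by fun_prop) (by fun_prop)
  have e : ∀ s : Finset ι,
      ((fun y : s → ℝ => ∑ i, y i) ∘ fun (x : ι → ℝ) (i : s) => x i) = coordSum s := fun s => by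
    ext x
    exact Finset.sum_coe_sort s x
  rw [e, e] at h2
  exact ⟨(measurable_coordSum s).prodMk (measurable_coordSum t), h2.map_prod_eq_prod_map_map
    (measurable_coordSum s).aemeasurable (measurable_coordSum t).aemeasurable⟩

lemma sumLaw_union {s t : Finset ι} (h : Disjoint s t) :
    sumLaw μ (s ∪ t) = sumLaw μ s ∗ sumLaw μ t := by
  have h1 := measurePreserving_coordSum_prod (μ := μ) h
  rw [Measure.conv, ← h1.map_eq, Measure.map_map (by fun_prop) h1.measurable, sumLaw]
  congr 1
  ext x
  exact coordSum_union h x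

lemma sumLaw_univ (s : Finset ι) : sumLaw μ Finset.univ = sumLaw μ s ∗ sumLaw μ sᶜ := by
  rw [← sumLaw_union disjoint_compl_right, Finset.union_compl]

omit [DecidableEq ι] in
lemma sumLaw_singleton (i : ι) : sumLaw μ {i} = μ i := by
  have : coordSum ({i} : Finset ι) = Function.eval i := by
    ext x; simp [coordSum]
  rw [sumLaw, this, (measurePreserving_eval μ i).map_eq]

lemma sumLaw_gaussianReal {m : ι → ℝ} {v : ι → ℝ≥0} (h : ∀ i, μ i = gaussianReal (m i) (v i))
    (s : Finset ι) : sumLaw μ s = gaussianReal (∑ i ∈ s, m i) (∑ i ∈ s, v i) := by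
  induction s using Finset.induction_on with
  | empty =>
    have : coordSum (∅ : Finset ι) = fun _ => 0 := by ext x; simp [coordSum]
    simp [sumLaw, this]
  | insert i s hi ih =>
    rw [Finset.insert_eq, sumLaw_union (by simpa using hi), sumLaw_singleton, h, ih,
      gaussianReal_conv_gaussianReal, ← Finset.insert_eq, Finset.sum_insert hi,
      Finset.sum_insert hi]

section Countable

/-- If a sum of independent variables is supported by a countable set, then so is each term. -/
lemma exists_countable_of_coordSum {s : Finset ι} {j : ι} (hj : j ∈ s) {S : Set ℝ}
    (hS : S.Countable) (h : ∀ᵐ x ∂(Measure.pi μ), coordSum s x ∈ S) :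
    ∃ S' : Set ℝ, S'.Countable ∧ ∀ᵐ x ∂(Measure.pi μ), x j ∈ S' := by
  have h1 := (measurePreserving_piecewise (μ := μ) {j}).quasiMeasurePreserving.ae h
  obtain ⟨x, hx⟩ := (Measure.ae_ae_of_ae_prod h1).exists
  refine ⟨(· + coordSum (s.erase j) x) ⁻¹' S, hS.preimage (add_left_injective _), ?_⟩
  filter_upwards [hx] with y hy
  have : coordSum s (({j} : Finset ι).piecewise y x) = y j + coordSum (s.erase j) x := by
    unfold coordSum
    rw [← Finset.add_sum_erase s _ hj]
    congr 1
    · simp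
    · refine Finset.sum_congr rfl fun i hi => ?_
      simp [(Finset.mem_erase.1 hi).1]
  rw [this] at hy
  exact hy

omit [∀ i, IsProbabilityMeasure (μ i)] in
lemma exists_countable_coordSum {s : Finset ι}
    (h : ∀ j ∈ s, ∃ S : Set ℝ, S.Countable ∧ ∀ᵐ x ∂(Measure.pi μ), x j ∈ S) :
    ∃ S : Set ℝ, S.Countable ∧ ∀ᵐ x ∂(Measure.pi μ), coordSum s x ∈ S := by
  induction s using Finset.induction_on with
  | empty => exact ⟨{0}, Set.countable_singleton 0, by simp [coordSum]⟩
  | insert j s hj ih =>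
    obtain ⟨S, hS, hS'⟩ := ih fun k hk => h k (Finset.mem_insert_of_mem hk)
    obtain ⟨S₁, hS₁, hS₁'⟩ := h j (Finset.mem_insert_self j s)
    refine ⟨Set.image2 (· + ·) S₁ S, hS₁.image2 hS _, ?_⟩
    filter_upwards [hS', hS₁'] with x hx hx1
    rw [coordSum, Finset.sum_insert hj]
    exact Set.mem_image2_of_mem hx1 hx

omit [DecidableEq ι] in
lemma not_ae_mem_countable {s : Finset ι} {f : ℝ → ℝ} (hf : IsACDensity (sumLaw μ s) f) {S : Set ℝ}
    (hS : S.Countable) : ¬ ∀ᵐ x ∂(Measure.pi μ), coordSum s x ∈ S := by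
  intro h
  have h1 : sumLaw μ s S = 0 := hf.absolutelyContinuous (hS.measure_zero volume)
  rw [sumLaw, Measure.map_apply (measurable_coordSum s) hS.measurableSet] at h1
  have h2 : ∀ᵐ x ∂(Measure.pi μ), ¬ coordSum s x ∈ S := by
    rw [ae_iff]
    simp only [not_not]
    exact h1
  obtain ⟨x, hx⟩ := (h.and h2).exists
  exact hx.2 hx.1

end Countable

section WeightedScore

variable {C : Finset (Finset ι)} {f : Finset ι → ℝ → ℝ} {w : Finset ι → ℝ}

/-- The score of the subset sum over `s`, with a weight, as a function of all the coordinates. -/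
noncomputable def weightedScore (f : Finset ι → ℝ → ℝ) (w : Finset ι → ℝ) (s : Finset ι)
    (x : ι → ℝ) : ℝ :=
  w s * score (f s) (coordSum s x)

omit [∀ i, IsProbabilityMeasure (μ i)] [DecidableEq ι] in
lemma measurable_weightedScore (hf : ∀ s ∈ C, IsACDensity (sumLaw μ s) (f s)) :
    ∀ s ∈ C, Measurable (weightedScore f w s) := fun s hs =>
  ((hf s hs).measurable_score.comp (measurable_coordSum s)).const_mul _

omit [Fintype ι] [DecidableEq ι] in
lemma dependsOn_weightedScore (s : Finset ι) : DependsOn (weightedScore f w s) (s : Set ι) :=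
  fun x y h => by rw [weightedScore, weightedScore, dependsOn_coordSum s h]

omit [DecidableEq ι] in
/-- Sums of infinite Fisher information are admitted, provided that they have weight zero. -/
lemma memLp_weightedScore (hf : ∀ s ∈ C, IsACDensity (sumLaw μ s) (f s))
    (hw : ∀ s ∈ C, w s ≠ 0 → fisherInfo (sumLaw μ s) ≠ ∞) :
    ∀ s ∈ C, MemLp (weightedScore f w s) 2 (Measure.pi μ) := by
  intro s hs
  by_cases h : w s = 0
  · have : weightedScore f w s = 0 := by ext x; simp [weightedScore, h]
    rw [this]
    exact MemLp.zero
  · exact (((hf s hs).memLp_score (hw s hs h)).comp_measurePreserving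
      (measurePreserving_coordSum s)).const_mul (w s)

omit [DecidableEq ι] [∀ i, IsProbabilityMeasure (μ i)] in
lemma integral_comp_coordSum {s : Finset ι} {g : ℝ → ℝ} (hg : Measurable g) :
    ∫ x, g (coordSum s x) ∂(Measure.pi μ) = ∫ t, g t ∂(sumLaw μ s) :=
  (integral_map (measurable_coordSum s).aemeasurable hg.aestronglyMeasurable).symm

omit [DecidableEq ι] in
lemma integral_weightedScore (hf : ∀ s ∈ C, IsACDensity (sumLaw μ s) (f s))
    (hw : ∀ s ∈ C, w s ≠ 0 → fisherInfo (sumLaw μ s) ≠ ∞) :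
    ∀ s ∈ C, ∫ x, weightedScore f w s x ∂(Measure.pi μ) = 0 := by
  intro s hs
  by_cases h : w s = 0
  · simp [weightedScore, h]
  · unfold weightedScore
    rw [integral_const_mul, integral_comp_coordSum (hf s hs).measurable_score,
      (hf s hs).integral_score (hw s hs h), mul_zero]

omit [∀ i, IsProbabilityMeasure (μ i)] [DecidableEq ι] in
lemma integral_weightedScore_sq (hf : ∀ s ∈ C, IsACDensity (sumLaw μ s) (f s)) :
    ∀ s ∈ C, ∫ x, weightedScore f w s x ^ 2 ∂(Measure.pi μ)
      = w s ^ 2 * ∫ t, score (f s) t ^ 2 ∂(sumLaw μ s) := by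
  intro s hs
  simp only [weightedScore, mul_pow]
  rw [integral_const_mul, integral_comp_coordSum ((hf s hs).measurable_score.pow_const 2)]

/-- If the sum over `s` has finite Fisher information, then so has the total sum, and the score of
the total sum is the conditional expectation of the score of the sum over `s`. -/
lemma exists_score_univ {s : Finset ι} {g : ℝ → ℝ} (hg : IsACDensity (sumLaw μ s) g)
    (hI : fisherInfo (sumLaw μ s) ≠ ∞) :
    ∃ F, IsACDensity (sumLaw μ Finset.univ) F ∧ MemLp (score F) 2 (sumLaw μ Finset.univ) ∧
      ∫ x, score F (coordSum Finset.univ x) * score g (coordSum s x) ∂(Measure.pi μ)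
        = ∫ t, score F t ^ 2 ∂(sumLaw μ Finset.univ) := by
  have e := sumLaw_univ (μ := μ) s
  have hF := hg.conv (ν := sumLaw μ sᶜ) hI
  have h2 := hg.memLp_score_conv (ν := sumLaw μ sᶜ) hI
  refine ⟨convFun g (sumLaw μ sᶜ), by rwa [e], by rwa [e], ?_⟩
  have h3 := hg.integral_mul_score_conv (ν := sumLaw μ sᶜ) hI hF.measurable_score h2
  have h4 := measurePreserving_coordSum_prod (μ := μ) (disjoint_compl_right (a := s))
  rw [e]
  simp only [pow_two]
  rw [← h3, ← h4.map_eq, integral_map h4.measurable.aemeasurable]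
  · congr 1
    ext x
    rw [← coordSum_union disjoint_compl_right, Finset.union_compl]
  · have := hF.measurable_score
    have := hg.measurable_score
    fun_prop

/-- The square of the distance from the score of the total sum to a weighted mean of the scores of
the subset sums. -/
lemma integral_sub_score_sq (hf : ∀ s ∈ C, IsACDensity (sumLaw μ s) (f s))
    (hw : ∀ s ∈ C, w s ≠ 0 → fisherInfo (sumLaw μ s) ≠ ∞) (hsum : ∑ s ∈ C, w s = 1) :
    ∃ F, IsACDensity (sumLaw μ Finset.univ) F ∧ MemLp (score F) 2 (sumLaw μ Finset.univ) ∧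
      Integrable (fun x => (∑ s ∈ C, weightedScore f w s x
        - score F (coordSum Finset.univ x)) ^ 2) (Measure.pi μ) ∧
      ∫ x, (∑ s ∈ C, weightedScore f w s x - score F (coordSum Finset.univ x)) ^ 2 ∂(Measure.pi μ)
        = ∫ x, (∑ s ∈ C, weightedScore f w s x) ^ 2 ∂(Measure.pi μ)
          - ∫ t, score F t ^ 2 ∂(sumLaw μ Finset.univ) := by
  obtain ⟨s₀, hs₀, hw₀⟩ : ∃ s ∈ C, w s ≠ 0 := by
    by_contra! hcon
    rw [Finset.sum_eq_zero hcon] at hsum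
    exact zero_ne_one hsum
  obtain ⟨F, hF, hF2, -⟩ := exists_score_univ (hf s₀ hs₀) (hw s₀ hs₀ hw₀)
  have hψ2 := memLp_weightedScore hf hw
  have hT2 : MemLp (fun x => score F (coordSum Finset.univ x)) 2 (Measure.pi μ) :=
    hF2.comp_measurePreserving (measurePreserving_coordSum _)
  have hΨ2 : MemLp (fun x => ∑ s ∈ C, weightedScore f w s x) 2 (Measure.pi μ) :=
    memLp_finsetSum C hψ2
  have hcross : ∀ s ∈ C, ∫ x, score F (coordSum Finset.univ x) * weightedScore f w s x
      ∂(Measure.pi μ) = w s * ∫ t, score F t ^ 2 ∂(sumLaw μ Finset.univ) := by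
    intro s hs
    by_cases h : w s = 0
    · simp [weightedScore, h]
    · obtain ⟨F', hF', -, h3⟩ := exists_score_univ (hf s hs) (hw s hs h)
      rw [hF'.unique hF] at h3
      rw [← h3, ← integral_const_mul]
      congr 1
      ext x
      rw [weightedScore]
      ring
  have hcross' : ∫ x, score F (coordSum Finset.univ x) * ∑ s ∈ C, weightedScore f w s x
      ∂(Measure.pi μ) = ∫ t, score F t ^ 2 ∂(sumLaw μ Finset.univ) := by
    have i0 : ∀ s ∈ C, Integrable (fun x => score F (coordSum Finset.univ x)
        * weightedScore f w s x) (Measure.pi μ) := fun s hs => hT2.integrable_mul (hψ2 s hs)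
    simp only [Finset.mul_sum]
    rw [integral_finsetSum _ i0, Finset.sum_congr rfl hcross,
      ← Finset.sum_mul, hsum, one_mul]
  refine ⟨F, hF, hF2, (hΨ2.sub hT2).integrable_sq, ?_⟩
  have i1 := hΨ2.integrable_sq
  have i2 := hT2.integrable_sq
  have i3 : Integrable (fun x => score F (coordSum Finset.univ x)
      * ∑ s ∈ C, weightedScore f w s x) (Measure.pi μ) := hT2.integrable_mul hΨ2
  have i4 : Integrable (fun x => (∑ s ∈ C, weightedScore f w s x) ^ 2
      - 2 * (score F (coordSum Finset.univ x) * ∑ s ∈ C, weightedScore f w s x)) (Measure.pi μ) :=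
    i1.sub (i3.const_mul 2)
  have e1 : ∀ x, (∑ s ∈ C, weightedScore f w s x - score F (coordSum Finset.univ x)) ^ 2
      = (∑ s ∈ C, weightedScore f w s x) ^ 2
        - 2 * (score F (coordSum Finset.univ x) * ∑ s ∈ C, weightedScore f w s x)
        + score F (coordSum Finset.univ x) ^ 2 := fun x => by ring
  simp only [e1]
  rw [integral_add i4 i2, integral_sub i1 (i3.const_mul 2),
    integral_const_mul, hcross',
    integral_comp_coordSum (g := fun t => score F t ^ 2) (hF.measurable_score.pow_const 2)]
  ring

end WeightedScore

end SubsetSums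

/-! ### The case of equality -/

section EqualityCase

variable {ι : Type*} [Fintype ι] [DecidableEq ι]

lemma ae_sub_eq_avgOut_sub {α : Type*} [MeasurableSpace α] {μ : ι → Measure α}
    [∀ i, IsProbabilityMeasure (μ i)] {A : Finset ι} {φ ψ : (ι → α) → ℝ} {c : ℝ}
    (hφ : MemLp φ 2 (Measure.pi μ)) (hφm : Measurable φ)
    (hψ : MemLp ψ 2 (Measure.pi μ)) (hψm : Measurable ψ)
    (h : ∀ᵐ x ∂(Measure.pi μ), φ x - avgOut μ A φ x = c * (ψ x - avgOut μ A ψ x)) :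
    ∀ᵐ x ∂(Measure.pi μ), φ x - c * ψ x = avgOut μ A (fun x => φ x - c * ψ x) x := by
  filter_upwards [h, ae_memLp_piecewise (A := A) hφ hφm, ae_memLp_piecewise (A := A) hψ hψm]
    with x hx h1 h2
  have : avgOut μ A (fun x => φ x - c * ψ x) x = avgOut μ A φ x - c * avgOut μ A ψ x := by
    unfold avgOut
    rw [integral_sub (h1.integrable (by norm_num)) ((h2.integrable (by norm_num)).const_mul c),
      integral_const_mul]
  rw [this]
  linarith

/-- A centred function that does not depend on any single coordinate vanishes. -/
lemma ae_eq_zero_of_eq_avgOut {α : Type*} [MeasurableSpace α] {μ : ι → Measure α}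
    [∀ i, IsProbabilityMeasure (μ i)] {R : (ι → α) → ℝ} (hR : ∫ x, R x ∂(Measure.pi μ) = 0)
    (h : ∀ i, ∀ᵐ x ∂(Measure.pi μ), R x = avgOut μ {i} R x) :
    ∀ᵐ x ∂(Measure.pi μ), R x = 0 := by
  obtain ⟨x, hx⟩ := (Measure.ae_ae_of_ae_prod
    (ae_piecewise_eq Finset.univ fun i _ => h i)).exists
  simp only [Finset.piecewise_univ] at hx
  have : R x = 0 := by
    rw [← hR, integral_congr_ae hx]
    simp
  rwa [this] at hx

variable {μ : ι → Measure ℝ} [∀ i, IsProbabilityMeasure (μ i)]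

/-- Suppose that the difference between the score of the total sum and a multiple of the score of
the sum over `s` does not depend on the coordinates in `s`. Unless the total sum is normal, the sum
over the complement of `s` is then supported by a countable set. -/
lemma exists_countable_coordSum_compl {s : Finset ι} {g F : ℝ → ℝ}
    (hg : IsACDensity (sumLaw μ s) g) (hF : IsACDensity (sumLaw μ Finset.univ) F) {α : ℝ}
    (hα : α ≠ 0) {R : (ι → ℝ) → ℝ}
    (hR : ∀ᵐ x ∂(Measure.pi μ),
      R x = score F (coordSum Finset.univ x) - α * score g (coordSum s x))
    (h : ∀ i ∈ s, ∀ᵐ x ∂(Measure.pi μ), R x = avgOut μ {i} R x)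
    (hG : ¬ ∃ (m : ℝ) (v : ℝ≥0), 0 < v ∧ sumLaw μ Finset.univ = gaussianReal m v) :
    ∃ S : Set ℝ, S.Countable ∧ ∀ᵐ x ∂(Measure.pi μ), coordSum sᶜ x ∈ S := by
  refine ⟨_, not_not.1 fun hc => hG (hg.eq_gaussianReal_of_not_countable hF hα hc), ?_⟩
  have h1 : ∀ᵐ p ∂((Measure.pi μ).prod (Measure.pi μ)),
      score F (coordSum s p.2 + coordSum sᶜ p.1) = α * score g (coordSum s p.2) + R p.1 := by
    filter_upwards [ae_piecewise_eq s h,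
      (measurePreserving_piecewise (μ := μ) s).quasiMeasurePreserving.ae hR] with p hp1 hp2
    have e1 : coordSum s (s.piecewise p.2 p.1) = coordSum s p.2 :=
      Finset.sum_congr rfl fun i hi => by simp [Finset.mem_coe.1 hi]
    have e2 : coordSum sᶜ (s.piecewise p.2 p.1) = coordSum sᶜ p.1 :=
      Finset.sum_congr rfl fun i hi => by simp [Finset.mem_compl.1 hi]
    rw [← Finset.union_compl s, coordSum_union disjoint_compl_right, e1, e2, hp1] at hp2
    linarith
  filter_upwards [Measure.ae_ae_of_ae_prod h1] with x hx
  refine ⟨R x, ?_⟩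
  have := hF.measurable_score
  have := hg.measurable_score
  rw [sumLaw, ae_map_iff (measurable_coordSum s).aemeasurable
    (measurableSet_eq_fun (by fun_prop) (by fun_prop))]
  exact hx

variable {C : Finset (Finset ι)} {f : Finset ι → ℝ → ℝ} {w : Finset ι → ℝ} {r : ℕ}

/-- If the variance drop inequality is an equality for a weighted mean of the scores of the subset
sums, and this mean is the score of the total sum, then the total sum is normal. -/
theorem exists_sumLaw_univ_eq_gaussianReal [Nontrivial ι]
    (hf : ∀ s ∈ C, IsACDensity (sumLaw μ s) (f s))
    (hw : ∀ s ∈ C, w s ≠ 0 → fisherInfo (sumLaw μ s) ≠ ∞)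
    (hr : ∀ i, (C.filter (i ∈ ·)).card ≤ r)
    (hdisc : ∀ i j : ι, i ≠ j → ∃ s ∈ C, i ∈ s ∧ j ∉ s)
    {F : ℝ → ℝ} (hF : IsACDensity (sumLaw μ Finset.univ) F)
    (hΨ : ∀ᵐ x ∂(Measure.pi μ),
      ∑ s ∈ C, weightedScore f w s x = score F (coordSum Finset.univ x))
    (heq : ∫ x, (∑ s ∈ C, weightedScore f w s x) ^ 2 ∂(Measure.pi μ)
      = r * ∑ s ∈ C, ∫ x, weightedScore f w s x ^ 2 ∂(Measure.pi μ))
    (hpos : ∫ x, (∑ s ∈ C, weightedScore f w s x) ^ 2 ∂(Measure.pi μ) ≠ 0) :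
    ∃ (m : ℝ) (v : ℝ≥0), 0 < v ∧ sumLaw μ Finset.univ = gaussianReal m v := by
  have hm := measurable_weightedScore (w := w) hf
  have h2 := memLp_weightedScore hf hw
  have hmean := integral_weightedScore hf hw
  have hr0 : (r : ℝ) ≠ 0 := fun h => hpos (by rw [heq, h, zero_mul])
  have hR : ∀ s ∈ C, ∀ i ∈ s, ∀ᵐ x ∂(Measure.pi μ),
      ∑ s ∈ C, weightedScore f w s x - r * weightedScore f w s x
        = avgOut μ {i} (fun x => ∑ s ∈ C, weightedScore f w s x - r * weightedScore f w s x) x :=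
    fun s hs i hi => ae_sub_eq_avgOut_sub (memLp_finsetSum C h2) (Finset.measurable_fun_sum _ hm)
      (h2 s hs) (hm s hs)
      (variance_drop_eq (S := id) hm h2 (fun s _ => dependsOn_weightedScore s) hr hmean heq hs hi)
  -- Some index lies in no set of weight zero, since otherwise the mean of the scores would not
  -- depend on any coordinate.
  obtain ⟨i, hi⟩ : ∃ i, ∀ s ∈ C, i ∈ s → w s ≠ 0 := by
    by_contra! hcon
    have h0 : ∀ᵐ x ∂(Measure.pi μ), ∑ s ∈ C, weightedScore f w s x = 0 := by
      refine ae_eq_zero_of_eq_avgOut ?_ fun i => ?_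
      · rw [integral_finsetSum _ fun s hs => (h2 s hs).integrable (by norm_num)]
        exact Finset.sum_eq_zero hmean
      · obtain ⟨s, hs, his, hws⟩ := hcon i
        simpa [weightedScore, hws] using hR s hs i his
    refine hpos (integral_eq_zero_of_ae ?_)
    filter_upwards [h0] with x hx
    simp [hx]
  by_contra hG
  have hc : ∀ s ∈ C, i ∈ s →
      ∃ S : Set ℝ, S.Countable ∧ ∀ᵐ x ∂(Measure.pi μ), coordSum sᶜ x ∈ S := by
    intro s hs his
    refine exists_countable_coordSum_compl (hf s hs) hF (mul_ne_zero hr0 (hi s hs his)) ?_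
      (hR s hs) hG
    filter_upwards [hΨ] with x hx
    rw [hx, weightedScore, mul_assoc]
  have hcj : ∀ j, j ≠ i → ∃ S : Set ℝ, S.Countable ∧ ∀ᵐ x ∂(Measure.pi μ), x j ∈ S := by
    intro j hj
    obtain ⟨s, hs, his, hjs⟩ := hdisc i j hj.symm
    obtain ⟨S, hS, hS'⟩ := hc s hs his
    exact exists_countable_of_coordSum (Finset.mem_compl.2 hjs) hS hS'
  -- A set of the collection that does not contain `i` now has a countably supported sum.
  obtain ⟨j, hj⟩ := exists_ne i
  obtain ⟨s, hs, hjs, his⟩ := hdisc j i hj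
  obtain ⟨S, hS, hS'⟩ := exists_countable_coordSum (s := s) fun k hk =>
    hcj k fun h => his (h ▸ hk)
  exact not_ae_mem_countable (hf s hs) hS hS'

end EqualityCase

/-! ### The information inequality -/

section Information

variable {ι : Type*} [Fintype ι] [DecidableEq ι] {μ : ι → Measure ℝ}
  [∀ i, IsProbabilityMeasure (μ i)] {C : Finset (Finset ι)} {r : ℕ}

/-- The information inequality for subset sums on a product space, with its case of equality. The
weights of the scores are proportional to the reciprocals of the Fisher informations, which is the
choice that minimizes the bound given by `variance_drop`. -/
theorem sum_one_div_fisherInfo_le (hC : ∀ s ∈ C, HasACDensity (sumLaw μ s))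
    (hr : ∀ i, (C.filter (i ∈ ·)).card ≤ r)
    (hpos : ∑ s ∈ C, 1 / fisherInfo (sumLaw μ s) ≠ 0) :
    ∑ s ∈ C, 1 / fisherInfo (sumLaw μ s) ≤ r * (1 / fisherInfo (sumLaw μ Finset.univ)) ∧
    (∑ s ∈ C, 1 / fisherInfo (sumLaw μ s) = r * (1 / fisherInfo (sumLaw μ Finset.univ)) →
      Nontrivial ι → (∀ i j : ι, i ≠ j → ∃ s ∈ C, i ∈ s ∧ j ∉ s) →
      ∃ (m : ℝ) (v : ℝ≥0), 0 < v ∧ sumLaw μ Finset.univ = gaussianReal m v) := by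
  have : ∀ s, ∃ f, s ∈ C → IsACDensity (sumLaw μ s) f := fun s => by
    by_cases hs : s ∈ C
    · obtain ⟨f, hf⟩ := hC s hs
      exact ⟨f, fun _ => hf⟩
    · exact ⟨0, fun h => absurd h hs⟩
  choose f hf using this
  set a : Finset ι → ℝ := fun s => (1 / fisherInfo (sumLaw μ s)).toReal with ha
  set A := ∑ s ∈ C, a s with hA
  have hb : ∀ s ∈ C, 1 / fisherInfo (sumLaw μ s) ≠ ∞ := fun s hs => by
    simpa using (hf s hs).fisherInfo_ne_zero
  have hAsum : ∑ s ∈ C, 1 / fisherInfo (sumLaw μ s) = ENNReal.ofReal A := by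
    rw [hA, ENNReal.ofReal_sum_of_nonneg fun s _ => ENNReal.toReal_nonneg]
    exact Finset.sum_congr rfl fun s hs => (ENNReal.ofReal_toReal (hb s hs)).symm
  have hA0 : 0 < A := by
    rw [hAsum] at hpos
    exact ENNReal.ofReal_pos.1 (pos_iff_ne_zero.2 hpos)
  set w : Finset ι → ℝ := fun s => a s / A with hwdef
  have hw : ∀ s ∈ C, w s ≠ 0 → fisherInfo (sumLaw μ s) ≠ ∞ := by
    intro s _ hws htop
    refine hws ?_
    simp [hwdef, ha, htop]
  have hwsum : ∑ s ∈ C, w s = 1 := by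
    rw [hwdef, ← Finset.sum_div, div_self hA0.ne']
  have hsq : ∑ s ∈ C, ∫ x, weightedScore f w s x ^ 2 ∂(Measure.pi μ) = 1 / A := by
    have h1 : ∀ s ∈ C, ∫ x, weightedScore f w s x ^ 2 ∂(Measure.pi μ) = a s / A ^ 2 := by
      intro s hs
      rw [integral_weightedScore_sq hf s hs]
      by_cases has : a s = 0
      · simp [hwdef, has]
      · have h2 := (hf s hs).memLp_score (hw s hs (div_ne_zero has hA0.ne'))
        have h3 : a s = 1 / ∫ t, score (f s) t ^ 2 ∂(sumLaw μ s) := by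
          simp only [ha]
          rw [(hf s hs).fisherInfo_eq_ofReal h2, ENNReal.toReal_div, ENNReal.toReal_ofReal
            (integral_nonneg fun t => sq_nonneg _), ENNReal.toReal_one]
        have h4 : ∫ t, score (f s) t ^ 2 ∂(sumLaw μ s) ≠ 0 := fun h => has (by rw [h3, h, div_zero])
        simp only [hwdef, h3]
        field_simp
    rw [Finset.sum_congr rfl h1, ← Finset.sum_div, ← hA]
    field_simp
  obtain ⟨F, hF, hF2, hi, hsub⟩ := integral_sub_score_sq hf hw hwsum
  have hdrop := variance_drop (S := id) (r := r) Finset.univ (fun s _ => Finset.subset_univ s)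
    (measurable_weightedScore hf) (memLp_weightedScore hf hw)
    (fun s _ => dependsOn_weightedScore s) hr (integral_weightedScore hf hw)
  have hI := hF.fisherInfo_eq_ofReal hF2
  have hI0 := hF.fisherInfo_ne_zero
  set J := ∫ t, score F t ^ 2 ∂(sumLaw μ Finset.univ) with hJ
  have hJ0 : 0 < J := by
    rw [hI] at hI0
    exact ENNReal.ofReal_pos.1 (pos_iff_ne_zero.2 hI0)
  have hnn : 0 ≤ ∫ x, (∑ s ∈ C, weightedScore f w s x - score F (coordSum Finset.univ x)) ^ 2
      ∂(Measure.pi μ) := integral_nonneg fun x => sq_nonneg _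
  have hrJ : (r : ℝ≥0∞) * (1 / fisherInfo (sumLaw μ Finset.univ)) = ENNReal.ofReal (r / J) := by
    rw [hI, ENNReal.ofReal_div_of_pos hJ0, ENNReal.ofReal_natCast, mul_one_div]
  rw [hsq] at hdrop
  rw [hrJ, hAsum]
  refine ⟨ENNReal.ofReal_le_ofReal ?_, fun heq hnt hdisc => ?_⟩
  · rw [le_div_iff₀ hJ0]
    have h1 : J ≤ r * (1 / A) := by linarith
    calc A * J ≤ A * (r * (1 / A)) := by gcongr
      _ = r := by field_simp
  · rw [ENNReal.ofReal_eq_ofReal_iff hA0.le (by positivity)] at heq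
    have h1 : (r : ℝ) * (1 / A) = J := by
      rw [eq_div_iff hJ0.ne'] at heq
      rw [← heq]
      field_simp
    have h2 : ∫ x, (∑ s ∈ C, weightedScore f w s x) ^ 2 ∂(Measure.pi μ) = J := by linarith
    have h3 := (integral_eq_zero_iff_of_nonneg (fun x => sq_nonneg _) hi).1
      (by rw [hsub, h2, sub_self])
    refine exists_sumLaw_univ_eq_gaussianReal hf hw hr hdisc hF ?_ ?_ ?_
    · filter_upwards [h3] with x hx
      exact sub_eq_zero.1 (pow_eq_zero_iff two_ne_zero |>.1 hx)
    · rw [h2, hsq, h1]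
    · rw [h2]
      exact hJ0.ne'

/-- **Information inequality for subset sums.** -/
theorem one_div_fisherInfo_sumLaw_univ_ge (hC : ∀ s ∈ C, HasACDensity (sumLaw μ s))
    (hr : ∀ i, (C.filter (i ∈ ·)).card ≤ r) :
    1 / (r : ℝ≥0∞) * ∑ s ∈ C, 1 / fisherInfo (sumLaw μ s)
      ≤ 1 / fisherInfo (sumLaw μ Finset.univ) := by
  rcases eq_or_ne (∑ s ∈ C, 1 / fisherInfo (sumLaw μ s)) 0 with h | h
  · rw [h, mul_zero]
    exact zero_le
  · rw [one_div (r : ℝ≥0∞), mul_comm, ← div_eq_mul_inv]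
    refine ENNReal.div_le_of_le_mul ?_
    rw [mul_comm]
    exact (sum_one_div_fisherInfo_le hC hr h).1

/-- Double counting of the pairs `i ∈ s` with `s ∈ C`. -/
lemma sum_sum_eq_sum_card_mul (v : ι → ℝ≥0) :
    ∑ s ∈ C, ∑ i ∈ s, v i = ∑ i, (C.filter (i ∈ ·)).card * v i := by
  have : ∀ s : Finset ι, ∑ i ∈ s, v i = ∑ i, if i ∈ s then v i else 0 := fun s => by simp
  simp only [this]
  rw [Finset.sum_comm]
  refine Finset.sum_congr rfl fun i _ => ?_
  rw [← Finset.sum_filter, Finset.sum_const, nsmul_eq_mul]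

/-- For normal variables, both sides of the information inequality are sums of variances. -/
lemma sum_one_div_fisherInfo_gaussianReal {m : ι → ℝ} {v : ι → ℝ≥0}
    (h : ∀ i, μ i = gaussianReal (m i) (v i)) :
    ∑ s ∈ C, 1 / fisherInfo (sumLaw μ s)
      = ((∑ i, (C.filter (i ∈ ·)).card * v i : ℝ≥0) : ℝ≥0∞) := by
  rw [← sum_sum_eq_sum_card_mul]
  simp only [sumLaw_gaussianReal h, one_div_fisherInfo_gaussianReal]
  push_cast
  rfl

lemma exists_gaussianReal_of_sumLaw_univ {m : ℝ} {v : ℝ≥0}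
    (h : sumLaw μ Finset.univ = gaussianReal m v) (i : ι) :
    ∃ (m' : ℝ) (v' : ℝ≥0), μ i = gaussianReal m' v' := by
  rw [sumLaw_univ {i}, sumLaw_singleton] at h
  exact cramer h

/-- Equality holds exactly for normal variables and collections in which all indices occur equally
often. -/
theorem fisherInfo_eq_iff [Nontrivial ι] (hC : ∀ s ∈ C, HasACDensity (sumLaw μ s))
    (hr : ∀ i, (C.filter (i ∈ ·)).card ≤ r) (hr0 : r ≠ 0)
    (hdisc : ∀ i j : ι, i ≠ j → ∃ s ∈ C, i ∈ s ∧ j ∉ s)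
    (hμ : ∀ i c, μ i ≠ Measure.dirac c) :
    (0 < 1 / fisherInfo (sumLaw μ Finset.univ) ∧
      0 < 1 / (r : ℝ≥0∞) * ∑ s ∈ C, 1 / fisherInfo (sumLaw μ s) ∧
      1 / fisherInfo (sumLaw μ Finset.univ)
        = 1 / (r : ℝ≥0∞) * ∑ s ∈ C, 1 / fisherInfo (sumLaw μ s)) ↔
    (∀ i, ∃ (m : ℝ) (v : ℝ≥0), 0 < v ∧ μ i = gaussianReal m v) ∧
      ∀ i, (C.filter (i ∈ ·)).card = r := by
  have hr1 : (r : ℝ≥0∞) ≠ 0 := by exact_mod_cast hr0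
  have hr2 : (r : ℝ≥0∞) ≠ ∞ := ENNReal.natCast_ne_top r
  have hmul : ∀ a b : ℝ≥0∞, a = 1 / (r : ℝ≥0∞) * b ↔ b = r * a := fun a b => by
    rw [one_div]
    constructor
    · rintro rfl
      rw [← mul_assoc, ENNReal.mul_inv_cancel hr1 hr2, one_mul]
    · rintro rfl
      rw [← mul_assoc, ENNReal.inv_mul_cancel hr1 hr2, one_mul]
  rw [hmul]
  constructor
  · rintro ⟨-, h1, h2⟩
    obtain ⟨m, v, hv, hG⟩ := (sum_one_div_fisherInfo_le hC hr
      (fun h => h1.ne' (by rw [h, mul_zero]))).2 h2 ‹_› hdisc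
    choose m' v' hmv using exists_gaussianReal_of_sumLaw_univ hG
    have hv' : ∀ i, 0 < v' i := fun i => pos_iff_ne_zero.2 fun h0 => hμ i (m' i) (by
      rw [hmv, h0, gaussianReal_zero_var])
    refine ⟨fun i => ⟨m' i, v' i, hv' i, hmv i⟩, ?_⟩
    rw [sum_one_div_fisherInfo_gaussianReal hmv, sumLaw_gaussianReal hmv,
      one_div_fisherInfo_gaussianReal] at h2
    have h3 : ∑ i, ((C.filter (i ∈ ·)).card : ℝ≥0) * v' i = ∑ i, (r : ℝ≥0) * v' i := by
      rw [← Finset.mul_sum]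
      exact_mod_cast h2
    have h4 := (Finset.sum_eq_sum_iff_of_le fun i _ =>
      mul_le_mul_left (Nat.cast_le.2 (hr i)) (v' i)).1 h3
    intro i
    exact_mod_cast mul_right_cancel₀ (hv' i).ne' (h4 i (Finset.mem_univ i))
  · rintro ⟨hN, hB⟩
    choose m v hv hmv using hN
    have h2 : ∑ s ∈ C, 1 / fisherInfo (sumLaw μ s)
        = r * (1 / fisherInfo (sumLaw μ Finset.univ)) := by
      rw [sum_one_div_fisherInfo_gaussianReal hmv, sumLaw_gaussianReal hmv,
        one_div_fisherInfo_gaussianReal]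
      simp only [hB, ← Finset.mul_sum]
      push_cast
      rfl
    have h1 : 0 < 1 / fisherInfo (sumLaw μ Finset.univ) := by
      rw [sumLaw_gaussianReal hmv, one_div_fisherInfo_gaussianReal]
      exact_mod_cast Finset.sum_pos (fun i _ => hv i) Finset.univ_nonempty
    exact ⟨h1, by rwa [← (hmul _ _).2 h2], h2⟩

end Information

section SubsetSum

variable {Ω : Type*} [MeasurableSpace Ω] {P : Measure Ω} [IsProbabilityMeasure P] {n : ℕ}
  {X : Fin n → Ω → ℝ}

lemma map_subsetSum (hX : ∀ i, Measurable (X i)) (hindep : iIndepFun X P) (s : Finset (Fin n)) :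
    P.map (subsetSum X s) = sumLaw (fun i => P.map (X i)) s := by
  rw [sumLaw, ← (iIndepFun_iff_map_fun_eq_pi_map fun i => (hX i).aemeasurable).1 hindep,
    Measure.map_map (measurable_coordSum s) (measurable_pi_lambda _ hX)]
  rfl

omit [IsProbabilityMeasure P] in
lemma ae_eq_const_of_map_eq_dirac {Y : Ω → ℝ} (hY : Measurable Y) {c : ℝ}
    (h : P.map Y = Measure.dirac c) : ∀ᵐ ω ∂P, Y ω = c := by
  refine ae_of_ae_map (p := (· = c)) hY.aemeasurable ?_
  rw [h]
  simp

end SubsetSum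

theorem theorem2 {Ω : Type*} [MeasurableSpace Ω] (P : Measure Ω) [IsProbabilityMeasure P]
    (n : ℕ) (X : Fin n → Ω → ℝ) (hX : ∀ i, Measurable (X i)) (hindep : iIndepFun X P)
    (C : Finset (Finset (Fin n)))
    (hC : ∀ s ∈ C, HasACDensity (P.map (subsetSum X s))) :
    (1 / fisherInfo (P.map (subsetSum X Finset.univ)) ≥
      (1 / (maxCount C : ℝ≥0∞)) * ∑ s ∈ C, 1 / fisherInfo (P.map (subsetSum X s))) ∧
    (2 ≤ n → (∀ i, ¬ ∃ c : ℝ, ∀ᵐ ω ∂P, X i ω = c) → IsDiscriminating C →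
      ((0 < 1 / fisherInfo (P.map (subsetSum X Finset.univ)) ∧
          0 < (1 / (maxCount C : ℝ≥0∞)) * ∑ s ∈ C, 1 / fisherInfo (P.map (subsetSum X s)) ∧
          1 / fisherInfo (P.map (subsetSum X Finset.univ)) =
            (1 / (maxCount C : ℝ≥0∞)) * ∑ s ∈ C, 1 / fisherInfo (P.map (subsetSum X s))) ↔
        ((∀ i, IsNormalRV P (X i)) ∧ IsBalanced C))) := by
  have (i : Fin n) : IsProbabilityMeasure (P.map (X i)) :=
    Measure.isProbabilityMeasure_map (hX i).aemeasurable
  simp only [map_subsetSum hX hindep] at hC ⊢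
  have hr : ∀ i, (C.filter (i ∈ ·)).card ≤ maxCount C := fun i =>
    Finset.le_sup (f := indexCount C) (Finset.mem_univ i)
  refine ⟨one_div_fisherInfo_sumLaw_univ_ge hC hr, fun hn hconst hdisc => ?_⟩
  have : Nontrivial (Fin n) := Fin.nontrivial_iff_two_le.2 hn
  have hr0 : maxCount C ≠ 0 := by
    obtain ⟨i, j, hij⟩ := exists_pair_ne (Fin n)
    obtain ⟨s, hs, his, -⟩ := hdisc i j hij
    have : 0 < (C.filter (i ∈ ·)).card := Finset.card_pos.2 ⟨s, Finset.mem_filter.2 ⟨hs, his⟩⟩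
    exact (this.trans_le (hr i)).ne'
  exact fisherInfo_eq_iff hC hr hr0 hdisc fun i c h =>
    hconst i ⟨c, ae_eq_const_of_map_eq_dirac (hX i) h⟩
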